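/- For integers $d, a, n \ge 1$, let $q_d^{(a)}(n)$ denote the number of partitions of $n$ into parts that are all at least $a$ and differ pairwise by at least $d$. For integers $d, n \ge 1$ and $1 \le b \le d+2$, let $Q_d^{(b,-)}(n)$ denote the number of partitions of $n$ into parts (repetitions allowed) congruent to $\pm b$ modulo $d+3$, excluding the part $d+3-b$. If $d = 15$ or $d \ge 31$, then for all $n \ge 1$, $$q_d^{(1)}(n) \ge Q_{d-2}^{(1,-)}(n);$$ here $Q_{d-2}^{(1,-)}(n)$ counts the partitions of $n$ into parts congruent to $\pm 1$ modulo $d+1$, excluding the part $d$. -/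

import Mathlib

/-- `q_d^{(a)}(n)`: the number of partitions of `n` whose parts are all at least `a` and differ
pairwise by at least `d`. The parts are listed in increasing order, with multiplicity. -/
def diffPartitionCount (d a n : ℕ) : ℕ :=
  (Finset.univ.filter fun p : n.Partition =>
    (∀ x ∈ p.parts, a ≤ x) ∧ (p.parts.sort (· ≤ ·)).Pairwise fun x y => x + d ≤ y).card

/-- `Q_d^{(b,-)}(n)`, for `1 ≤ b ≤ d + 2`: the number of partitions of `n` into parts congruent
to `b` or `-b` modulo `d + 3`, excluding the part `d + 3 - b`. -/
def congPartitionCountMinus (d b n : ℕ) : ℕ :=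
  (Finset.univ.filter fun p : n.Partition =>
    ∀ x ∈ p.parts, ((x : ℤ) ≡ b [ZMOD d + 3] ∨ (x : ℤ) ≡ -b [ZMOD d + 3]) ∧
      (x : ℤ) ≠ d + 3 - b).card

/-! Let N = 2^r - 1. The engine is an inequality of Andrews: partitions of n into distinct parts
congruent modulo N to one of 1, 2, ..., 2^(r-1) are at most as numerous as sets of positive integers
with sum n and pairwise gaps at least N (`coeff_prod_le_card_sepSets`). Write a positive integer as
x = N * l + b with 1 ≤ b ≤ N. Consider sets in which consecutive elements z < x satisfy the
following: the pair (level of z plus number of binary ones of its residue, lowest bit of its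
residue) is lexicographically at most (level of x, leading bit of its residue). This condition
forces x - z ≥ N (`add_le_of_nextIndex`). The generating functions of such sets, sorted by largest
element, telescope by splitting off the lowest bit of a residue (`tailSeries_self_sub`). The
resulting recurrence is solved by nested q-binomial sums (`tailPoly_rec`), which tend to the product
for distinct parts (`levelPoly_congr_prod`).

The residue classes are stable under doubling, so Euler's binary splitting of multiplicities turns
repeated odd parts in these classes into distinct ones (`card_oddPower_le_card_sepSets`). It then
suffices to shrink parts congruent to ±1 modulo d + 1 injectively to such odd parts; ones make up
the lost sum (`card_le_card_sepSets_of_injection`).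

For d = 15 this works part by part with r = 4. For d ≥ 31 take r = 5: a part next to k * (d + 1)
goes to an integer at most 31 * k, except that d + 2 and 3 * d + 4 need a joint encoding. The images
have sum at most 31 * K + δ, where d * K + δ ≤ n and δ is 1 or 2. Finally, sets with gaps 31 and sum
31 * K + δ inject into sets with gaps d and sum n (`card_sepSets_stretch`). -/

section QBinomial

/-! ### Gaussian binomials and nested q-binomial sums. -/

variable {R : Type*} [CommRing R]

/-- The Gaussian binomial coefficient `[n, j]` in the variable `y`. -/
def gaussBinom (y : R) : ℕ → ℕ → R
  | _, 0 => 1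
  | 0, _ + 1 => 0
  | n + 1, j + 1 => gaussBinom y n j + y ^ (j + 1) * gaussBinom y n (j + 1)

@[simp] lemma gaussBinom_zero_right (y : R) (n : ℕ) : gaussBinom y n 0 = 1 := by
  cases n <;> rfl

lemma gaussBinom_succ_succ (y : R) (n j : ℕ) :
    gaussBinom y (n + 1) (j + 1) = gaussBinom y n j + y ^ (j + 1) * gaussBinom y n (j + 1) := rfl

lemma gaussBinom_eq_zero (y : R) {n j : ℕ} (h : n < j) : gaussBinom y n j = 0 := by
  induction n generalizing j with
  | zero => obtain ⟨j, rfl⟩ := Nat.exists_eq_succ_of_ne_zero h.ne'; rfl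
  | succ n ih =>
    obtain ⟨j, rfl⟩ := Nat.exists_eq_succ_of_ne_zero (by omega : j ≠ 0)
    rw [Nat.succ_eq_add_one, gaussBinom_succ_succ, ih (by omega), ih (by omega)]
    ring

/-- The quotient of neighbouring coefficients, cleared of denominators so that it holds in any
commutative ring. It converts one Pascal rule into the other. -/
lemma gaussBinom_ratio (y : R) {n j : ℕ} (h : j ≤ n) :
    (1 - y ^ (j + 1)) * gaussBinom y n (j + 1) = (1 - y ^ (n - j)) * gaussBinom y n j := by
  induction n generalizing j with
  | zero =>
    obtain rfl : j = 0 := by omega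
    simp [gaussBinom_eq_zero]
  | succ n ih =>
    rcases Nat.lt_or_ge n j with hj | hj
    · obtain rfl : j = n + 1 := by omega
      simp [gaussBinom_eq_zero]
    · have h1 := ih hj
      have e1 : y ^ (n + 1) = y ^ (j + 1) * y ^ (n - j) := by
        rw [← pow_add]; congr 1; omega
      have key : (1 - y ^ (j + 1)) * gaussBinom y (n + 1) (j + 1)
          = (1 - y ^ (n + 1)) * gaussBinom y n j := by
        rw [gaussBinom_succ_succ, e1]
        linear_combination y ^ (j + 1) * h1
      rw [key]
      rcases j with _ | j
      · simp
      · have h2 := ih (j := j) (by omega)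
        have e2 : n + 1 - (j + 1) = n - j := by omega
        have e3 : y ^ (n + 1) = y ^ (j + 1) * y ^ (n - j) := by
          rw [← pow_add]; congr 1; omega
        rw [e2, gaussBinom_succ_succ y n j, e3]
        linear_combination h2

lemma gaussBinom_succ_succ' (y : R) {n j : ℕ} (h : j ≤ n) :
    gaussBinom y (n + 1) (j + 1) = gaussBinom y n (j + 1) + y ^ (n - j) * gaussBinom y n j := by
  rw [gaussBinom_succ_succ]
  linear_combination -gaussBinom_ratio y h

lemma gaussBinom_absorb (y : R) {n j : ℕ} (h : j ≤ n + 1) :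
    (1 - y ^ (n + 1 - j)) * gaussBinom y (n + 1) j = (1 - y ^ (n + 1)) * gaussBinom y n j := by
  rcases j with _ | j
  · simp
  · have e2 : n + 1 - (j + 1) = n - j := by omega
    have e3 : y ^ (n + 1) = y ^ (j + 1) * y ^ (n - j) := by
      rw [← pow_add]; congr 1; omega
    rw [e2, gaussBinom_succ_succ, e3]
    linear_combination -gaussBinom_ratio y (by omega : j ≤ n)

/-- The generating function of the tails below the level `m` for `r` colours. -/
def levelPoly (y : R) (a : ℕ → R) : ℕ → ℕ → R
  | 0, _ => 1
  | r + 1, m => ∑ j ∈ Finset.range (m + 1),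
      a r ^ j * y ^ j.choose 2 * gaussBinom y m j * levelPoly y a r (m - j)

/-- The generating function of the tails below the colour `i` of the level `m + 1`. -/
def colourPoly (y : R) (a : ℕ → R) : ℕ → ℕ → ℕ → R
  | 0, _, _ => 1
  | r + 1, m, i =>
    if i ≤ r then ∑ j ∈ Finset.range (m + 1),
      a r ^ j * y ^ j.choose 2 * gaussBinom y m j * colourPoly y a r (m - j) i
    else levelPoly y a (r + 1) (m + 1)

variable (y : R) (a : ℕ → R)

lemma levelPoly_succ (r m : ℕ) : levelPoly y a (r + 1) m = ∑ j ∈ Finset.range (m + 1),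
    a r ^ j * y ^ j.choose 2 * gaussBinom y m j * levelPoly y a r (m - j) := rfl

lemma colourPoly_succ_of_le {r i : ℕ} (m : ℕ) (h : i ≤ r) :
    colourPoly y a (r + 1) m i = ∑ j ∈ Finset.range (m + 1),
      a r ^ j * y ^ j.choose 2 * gaussBinom y m j * colourPoly y a r (m - j) i := by
  rw [colourPoly, if_pos h]

lemma colourPoly_zero (r m : ℕ) : colourPoly y a r m 0 = levelPoly y a r m := by
  induction r generalizing m with
  | zero => rfl
  | succ r ih =>
    rw [colourPoly_succ_of_le y a m (Nat.zero_le _), levelPoly_succ]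
    exact Finset.sum_congr rfl fun j _ => by rw [ih]

lemma colourPoly_self (r m : ℕ) : colourPoly y a r m r = levelPoly y a r (m + 1) := by
  cases r with
  | zero => rfl
  | succ r => rw [colourPoly, if_neg (by omega)]

lemma levelPoly_at_zero (r : ℕ) : levelPoly y a r 0 = 1 := by
  induction r with
  | zero => rfl
  | succ r ih => simp [levelPoly_succ, ih]

/-- The second Pascal rule splits the outermost coefficient. One half, after a shift of j, is the
same sum one level lower; the other is the colour polynomial, because its inner factor at colour r
gains a level by `colourPoly_self`. -/
lemma levelPoly_succ_succ (r m : ℕ) :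
    levelPoly y a (r + 1) (m + 1)
      = colourPoly y a (r + 1) m r + a r * y ^ m * levelPoly y a (r + 1) m := by
  rw [levelPoly_succ, colourPoly_succ_of_le y a m le_rfl, levelPoly_succ, Finset.mul_sum]
  rw [Finset.sum_range_succ']
  have h1 : ∀ j ∈ Finset.range (m + 1),
      a r ^ (j + 1) * y ^ (j + 1).choose 2 * gaussBinom y (m + 1) (j + 1)
        * levelPoly y a r (m + 1 - (j + 1))
      = a r ^ (j + 1) * y ^ (j + 1).choose 2 * gaussBinom y m (j + 1) * levelPoly y a r (m - j)
        + a r * y ^ m * (a r ^ j * y ^ j.choose 2 * gaussBinom y m j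
          * levelPoly y a r (m - j)) := by
    intro j hj
    have hj : j ≤ m := by simpa [Nat.lt_succ_iff] using hj
    have e1 : (j + 1).choose 2 = j + j.choose 2 := by
      rw [Nat.choose_succ_succ' j 1]; simp
    have e2 : y ^ m = y ^ j * y ^ (m - j) := by rw [← pow_add]; congr 1; omega
    rw [gaussBinom_succ_succ' y hj, e1, e2, Nat.add_sub_add_right]
    ring
  rw [Finset.sum_congr rfl h1, Finset.sum_add_distrib]
  have h2 : ∑ j ∈ Finset.range (m + 1),
      a r ^ j * y ^ j.choose 2 * gaussBinom y m j * colourPoly y a r (m - j) r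
      = ∑ j ∈ Finset.range (m + 1), a r ^ (j + 1) * y ^ (j + 1).choose 2
          * gaussBinom y m (j + 1) * levelPoly y a r (m - j) + levelPoly y a r (m + 1) := by
    rw [Finset.sum_range_succ', Finset.sum_range_succ _ m, gaussBinom_eq_zero y (Nat.lt_succ_self m)]
    simp only [colourPoly_self]
    have : ∀ j ∈ Finset.range m, a r ^ (j + 1) * y ^ (j + 1).choose 2
          * gaussBinom y m (j + 1) * levelPoly y a r (m - (j + 1) + 1)
        = a r ^ (j + 1) * y ^ (j + 1).choose 2
          * gaussBinom y m (j + 1) * levelPoly y a r (m - j) := by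
      intro j hj
      have hj : j < m := by simpa using hj
      rw [show m - (j + 1) + 1 = m - j by omega]
    rw [Finset.sum_congr rfl this]
    simp
  rw [h2]
  simp
  ring

lemma colourPoly_rec_zero {r i : ℕ} (h : i < r) :
    colourPoly y a r 0 (i + 1) = colourPoly y a r 0 i + a i := by
  induction r with
  | zero => omega
  | succ r ih =>
    rcases Nat.lt_or_ge i r with hi | hi
    · rw [colourPoly_succ_of_le y a 0 (by omega), colourPoly_succ_of_le y a 0 (by omega)]
      simpa using ih hi
    · obtain rfl : i = r := by omega
      rw [colourPoly_self, levelPoly_succ_succ, levelPoly_at_zero]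
      ring

/-- Induction on the number of colours. The inner recurrence carries the factor 1 - y^(m+1-j), which
depends on j; `gaussBinom_absorb` trades it for 1 - y^(m+1), which leaves the sum. The term j = m +
1 has inner level zero and needs `colourPoly_rec_zero`. -/
lemma colourPoly_rec {r i : ℕ} (m : ℕ) (h : i < r) :
    colourPoly y a r (m + 1) (i + 1) = colourPoly y a r (m + 1) i
      + a i * (colourPoly y a r (m + 1) 0 - (1 - y ^ (m + 1)) * colourPoly y a r m (i + 1)) := by
  induction r generalizing m with
  | zero => omega
  | succ r ih =>
    rcases Nat.lt_or_ge i r with hi | hi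
    · have ih := fun m => ih m hi
      simp only [colourPoly_succ_of_le y a _ (by omega : i + 1 ≤ r),
        colourPoly_succ_of_le y a _ (by omega : i ≤ r), colourPoly_succ_of_le y a _ (Nat.zero_le r)]
      have h1 : ∀ j ∈ Finset.range (m + 1), a r ^ j * y ^ j.choose 2 * gaussBinom y (m + 1) j
            * colourPoly y a r (m + 1 - j) (i + 1)
          = a r ^ j * y ^ j.choose 2 * gaussBinom y (m + 1) j * colourPoly y a r (m + 1 - j) i
            + a i * (a r ^ j * y ^ j.choose 2 * gaussBinom y (m + 1) j
              * colourPoly y a r (m + 1 - j) 0)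
            - a i * (1 - y ^ (m + 1)) * (a r ^ j * y ^ j.choose 2 * gaussBinom y m j
              * colourPoly y a r (m - j) (i + 1)) := by
        intro j hj
        have hj : j ≤ m := by simpa [Nat.lt_succ_iff] using hj
        have e := gaussBinom_absorb y (by omega : j ≤ m + 1)
        rw [show m + 1 - j = m - j + 1 by omega] at e ⊢
        rw [ih]
        linear_combination -(a r ^ j * y ^ j.choose 2 * a i * colourPoly y a r (m - j) (i + 1)) * e
      rw [Finset.sum_range_succ _ (m + 1), Finset.sum_congr rfl h1, Finset.sum_sub_distrib,
        Finset.sum_add_distrib, ← Finset.mul_sum, ← Finset.mul_sum,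
        Finset.sum_range_succ _ (m + 1), Finset.sum_range_succ _ (m + 1), Nat.sub_self,
        colourPoly_rec_zero y a hi, colourPoly_zero y a r 0, levelPoly_at_zero]
      ring
    · obtain rfl : i = r := by omega
      rw [colourPoly_self, colourPoly_self, colourPoly_zero, levelPoly_succ_succ]
      ring

/-- `tailPoly y a r m i` is the generating function of the tails below the colour `i` of the
level `m`. -/
def tailPoly (r : ℕ) : ℕ → ℕ → R
  | 0, _ => 1
  | m + 1, i => colourPoly y a r m i

lemma tailPoly_succ_zero (r m : ℕ) : tailPoly y a r (m + 1) 0 = tailPoly y a r m r := by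
  cases m with
  | zero => simp [tailPoly, colourPoly_zero, levelPoly_at_zero]
  | succ m => simp only [tailPoly, colourPoly_zero, colourPoly_self]

/-- Of the two new terms, the first will stand for sets whose largest element has residue exactly
2^i, the second for those whose residue has lowest bit 2^i and further bits above it. -/
lemma tailPoly_rec {r i : ℕ} (m : ℕ) (h : i < r) :
    tailPoly y a r (m + 1) (i + 1) = tailPoly y a r (m + 1) i
      + a i * y ^ m * tailPoly y a r m (i + 1)
      + a i * (tailPoly y a r m r - tailPoly y a r m (i + 1)) := by
  cases m with
  | zero => simp [tailPoly, colourPoly_rec_zero y a h]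
  | succ m =>
    simp only [tailPoly]
    rw [colourPoly_rec y a m h, colourPoly_zero, colourPoly_self]
    ring

/-- The finite q-binomial theorem, read off from the level recurrence for a single colour. -/
lemma levelPoly_one_colour (b : R) (m : ℕ) :
    ∑ j ∈ Finset.range (m + 1), b ^ j * y ^ j.choose 2 * gaussBinom y m j
      = ∏ l ∈ Finset.range m, (1 + b * y ^ l) := by
  have key : ∀ m, levelPoly y (fun _ => b) 1 m = ∏ l ∈ Finset.range m, (1 + b * y ^ l) := by
    intro m
    induction m with
    | zero => simp [levelPoly_at_zero]
    | succ m ih =>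
      rw [levelPoly_succ_succ, colourPoly_succ_of_le _ _ _ le_rfl, Finset.prod_range_succ, ← ih]
      simp only [colourPoly, levelPoly]
      ring
  rw [← key m]
  simp [levelPoly]

end QBinomial

/-! ### Convergence of the nested sums to the infinite product. -/

section Limit

open PowerSeries

variable (N : ℕ)

lemma prod_stable (N e n m m' : ℕ) (hN : 1 ≤ N) (h : n + 1 ≤ m) (h' : m ≤ m') :
    (X : ℤ⟦X⟧) ^ (n + 1) ∣ ∏ l ∈ Finset.range m', (1 + X ^ e * (X ^ N) ^ l)
      - ∏ l ∈ Finset.range m, (1 + (X : ℤ⟦X⟧) ^ e * (X ^ N) ^ l) := by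
  induction m', h' using Nat.le_induction with
  | base => simp
  | succ k hk ih =>
    rw [Finset.prod_range_succ]
    have : (X : ℤ⟦X⟧) ^ (n + 1) ∣ X ^ e * (X ^ N) ^ k := by
      rw [← pow_mul, ← pow_add]
      apply pow_dvd_pow
      nlinarith
    have h2 := dvd_add ih (this.mul_left (∏ l ∈ Finset.range k, (1 + X ^ e * (X ^ N) ^ l)))
    convert h2 using 1
    ring

/-- Terms with j > n vanish modulo X^(n+1); for j ≤ n the inner factor at level m - j agrees with
its product at level m. Hence that product factors out and the q-binomial theorem evaluates the
rest. Each colour may cost n levels, whence the lower bound on m. -/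
lemma levelPoly_congr_prod (hN : 1 ≤ N) (a : ℕ → ℕ) (ha : ∀ i, 1 ≤ a i) (r n m : ℕ)
    (hm : (r + 1) * (n + 1) ≤ m) :
    (X : ℤ⟦X⟧) ^ (n + 1) ∣ levelPoly ((X : ℤ⟦X⟧) ^ N) (fun i => X ^ a i) r m
      - ∏ i ∈ Finset.range r, ∏ l ∈ Finset.range m, (1 + (X : ℤ⟦X⟧) ^ a i * (X ^ N) ^ l) := by
  induction r generalizing m with
  | zero => simp [levelPoly]
  | succ r ih =>
    have hm' : (r + 1) * (n + 1) + (n + 1) ≤ m := by linarith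
    set P : ℕ → ℤ⟦X⟧ := fun m => ∏ i ∈ Finset.range r, ∏ l ∈ Finset.range m,
      (1 + (X : ℤ⟦X⟧) ^ a i * (X ^ N) ^ l) with hP
    have hstab : ∀ m', n + 1 ≤ m' → m' ≤ m → (X : ℤ⟦X⟧) ^ (n + 1) ∣ P m - P m' := by
      intro m' h1 h2
      rw [← Ideal.mem_span_singleton, ← Ideal.Quotient.mk_eq_mk_iff_sub_mem]
      simp only [hP, map_prod (Ideal.Quotient.mk _)]
      refine Finset.prod_congr rfl fun i _ => ?_
      rw [← map_prod, ← map_prod, Ideal.Quotient.mk_eq_mk_iff_sub_mem, Ideal.mem_span_singleton]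
      exact prod_stable N (a i) n m' m hN h1 h2
    have hterm : ∀ j ∈ Finset.range (m + 1), (X : ℤ⟦X⟧) ^ (n + 1) ∣
        (X ^ a r) ^ j * (X ^ N) ^ j.choose 2 * gaussBinom ((X : ℤ⟦X⟧) ^ N) m j
          * (levelPoly ((X : ℤ⟦X⟧) ^ N) (fun i => X ^ a i) r (m - j) - P m) := by
      intro j hj
      rcases Nat.lt_or_ge n j with h | h
      · have : (X : ℤ⟦X⟧) ^ (n + 1) ∣ (X ^ a r) ^ j := by
          rw [← pow_mul]
          apply pow_dvd_pow
          nlinarith [ha r]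
        exact ((this.mul_right _).mul_right _).mul_right _
      · apply Dvd.dvd.mul_left
        have h1 := ih (m - j) (by omega)
        have h2 := hstab (m - j) (by nlinarith [Nat.sub_add_cancel (by omega : j ≤ m)]) (by omega)
        have h3 := dvd_sub h1 h2
        convert h3 using 1
        simp only [hP]
        ring
    rw [levelPoly_succ, Finset.prod_range_succ]
    have h4 := Finset.dvd_sum hterm
    convert h4 using 1
    simp only [mul_sub]
    rw [Finset.sum_sub_distrib, ← Finset.sum_mul, levelPoly_one_colour]
    ring

end Limit

/-! ### Sets with prescribed minimal gaps. -/

section SeparatedSets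

/-- The finite sets of positive integers, at most `x`, that differ pairwise by at least `N` and
have sum `n`. -/
def sepSets (N x n : ℕ) : Finset (Finset ℕ) :=
  (Finset.Icc 1 x).powerset.filter fun s =>
    (∀ u ∈ s, ∀ v ∈ s, u < v → u + N ≤ v) ∧ ∑ u ∈ s, u = n

lemma mem_sepSets {N x n : ℕ} {s : Finset ℕ} : s ∈ sepSets N x n ↔
    (∀ u ∈ s, 1 ≤ u ∧ u ≤ x) ∧ (∀ u ∈ s, ∀ v ∈ s, u < v → u + N ≤ v) ∧ ∑ u ∈ s, u = n := by
  simp [sepSets, Finset.subset_iff]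

/-- Sets avoiding x + 1, together with sets obtained by inserting it. If x + 1 < N, the truncated
bound is 0 and only the empty set can be enlarged, as it should be. -/
lemma card_sepSets_succ (N x n : ℕ) (hN : 1 ≤ N) (hx : x + 1 ≤ n) :
    (sepSets N x n).card + (sepSets N (x + 1 - N) (n - (x + 1))).card
      ≤ (sepSets N (x + 1) n).card := by
  have hnot : ∀ s ∈ sepSets N (x + 1 - N) (n - (x + 1)), x + 1 ∉ s := by
    intro s hs hmem
    have := ((mem_sepSets.1 hs).1 _ hmem).2
    omega
  have himg : ((sepSets N (x + 1 - N) (n - (x + 1))).image (insert (x + 1))).card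
      = (sepSets N (x + 1 - N) (n - (x + 1))).card := by
    apply Finset.card_image_of_injOn
    intro s hs t ht hst
    have := congrArg (fun u => u.erase (x + 1)) hst
    simpa [Finset.erase_insert (hnot s hs), Finset.erase_insert (hnot t ht)] using this
  rw [← himg, ← Finset.card_union_of_disjoint]
  · apply Finset.card_le_card
    intro s hs
    rcases Finset.mem_union.1 hs with h | h
    · obtain ⟨h1, h2, h3⟩ := mem_sepSets.1 h
      exact mem_sepSets.2 ⟨fun u hu => ⟨(h1 u hu).1, (h1 u hu).2.trans (Nat.le_succ x)⟩, h2, h3⟩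
    · obtain ⟨t, ht, rfl⟩ := Finset.mem_image.1 h
      obtain ⟨h1, h2, h3⟩ := mem_sepSets.1 ht
      refine mem_sepSets.2 ⟨?_, ?_, ?_⟩
      · intro u hu
        rcases Finset.mem_insert.1 hu with rfl | hu
        · omega
        · have := h1 u hu; omega
      · intro u hu v hv huv
        rcases Finset.mem_insert.1 hu with rfl | hu <;> rcases Finset.mem_insert.1 hv with rfl | hv
        · omega
        · have := h1 v hv; omega
        · have := h1 u hu; omega
        · exact h2 u hu v hv huv
      · rw [Finset.sum_insert (hnot t ht), h3]; omega
  · rw [Finset.disjoint_left]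
    intro s hs hs'
    obtain ⟨t, -, rfl⟩ := Finset.mem_image.1 hs'
    have := ((mem_sepSets.1 hs).1 _ (Finset.mem_insert_self _ _)).2
    omega

lemma sepSets_mono (N n : ℕ) {x x' : ℕ} (h : x ≤ x') : sepSets N x n ⊆ sepSets N x' n := by
  intro s hs
  obtain ⟨h1, h2, h3⟩ := mem_sepSets.1 hs
  exact mem_sepSets.2 ⟨fun u hu => ⟨(h1 u hu).1, (h1 u hu).2.trans h⟩, h2, h3⟩

end SeparatedSets

/-! ### Effect of a new lowest bit on bit count and leading bit. -/

section BinaryExpansion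

/-- The number of ones in the binary expansion. -/
def popCount (b : ℕ) : ℕ := b.bitIndices.length

lemma popCount_pos {b : ℕ} (h : b ≠ 0) : 1 ≤ popCount b := by
  rw [popCount, Nat.one_le_iff_ne_zero, Ne, List.length_eq_zero_iff]
  intro h0
  apply h
  rw [← Nat.sum_map_two_pow_bitIndices b, h0]
  simp

lemma popCount_two_pow (i : ℕ) : popCount (2 ^ i) = 1 := by simp [popCount]

lemma popCount_two_pow_add {i b : ℕ} (h : 2 ^ (i + 1) ∣ b) :
    popCount (2 ^ i + b) = popCount b + 1 := by
  obtain ⟨c, rfl⟩ := h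
  have e1 : 2 ^ i + 2 ^ (i + 1) * c = 2 ^ i * (2 * c + 1) := by ring
  rw [popCount, popCount, e1, Nat.bitIndices_two_pow_mul, Nat.bitIndices_two_pow_mul,
    Nat.bitIndices_two_mul_add_one]
  simp

lemma log_two_pow_add {i b : ℕ} (h : 2 ^ (i + 1) ∣ b) (hb : b ≠ 0) :
    Nat.log 2 (2 ^ i + b) = Nat.log 2 b := by
  have h1 := Nat.pow_log_le_self 2 hb
  have h2 := Nat.lt_pow_succ_log_self (b := 2) (by norm_num) b
  have h3 : i + 1 ≤ Nat.log 2 b :=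
    Nat.le_log_of_pow_le (by norm_num) (Nat.le_of_dvd (Nat.pos_of_ne_zero hb) h)
  rw [Nat.log_eq_iff (Or.inr ⟨by norm_num, by positivity⟩)]
  refine ⟨by omega, ?_⟩
  obtain ⟨k, hk⟩ : 2 ^ (i + 1) ∣ 2 ^ (Nat.log 2 b + 1) := pow_dvd_pow _ (by omega)
  obtain ⟨c, hc⟩ := h
  have hck : c + 1 ≤ k := by
    by_contra hlt
    have : 2 ^ (i + 1) * k ≤ 2 ^ (i + 1) * c := Nat.mul_le_mul_left _ (by omega)
    omega
  have h4 : 2 ^ (i + 1) * (c + 1) ≤ 2 ^ (i + 1) * k := Nat.mul_le_mul_left _ hck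
  have h5 : (2 : ℕ) ^ (i + 1) = 2 * 2 ^ i := by ring
  have h6 : 0 < (2 : ℕ) ^ i := by positivity
  rw [mul_add] at h4
  omega

end BinaryExpansion

/-! ### Andrews' inequality for modulus 2^r - 1. -/

section Andrews

open PowerSeries

/-- The generating function of the tails below the colour `i` of the level `m`, where the colour
`i` of the level `l` stands for the integer `(2 ^ r - 1) * l + 2 ^ i`. -/
noncomputable def tailSeries (r m i : ℕ) : ℤ⟦X⟧ :=
  tailPoly ((X : ℤ⟦X⟧) ^ (2 ^ r - 1)) (fun i => X ^ 2 ^ i) r m i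

/-- The generating function of the separated sets with largest element `(2 ^ r - 1) * l + b`. -/
noncomputable def topSeries (r l b : ℕ) : ℤ⟦X⟧ :=
  X ^ ((2 ^ r - 1) * l + b) * tailSeries r l (Nat.log 2 b + 1)

/-- `topSeries`, where the level is that of the element the set makes room for. -/
noncomputable def shiftedTopSeries (r m b : ℕ) : ℤ⟦X⟧ :=
  if popCount b ≤ m then topSeries r (m - popCount b) b else 0

lemma shiftedTopSeries_two_pow (r m i : ℕ) :
    shiftedTopSeries r (m + 1) (2 ^ i) = topSeries r m (2 ^ i) := by
  simp [shiftedTopSeries, popCount_two_pow]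

/-- A new lowest bit raises the bit count by one, which cancels the rise of m, and keeps the leading
bit. So level and tail are unchanged and only the monomial grows. -/
lemma shiftedTopSeries_two_pow_add (r m : ℕ) {i b : ℕ} (h : 2 ^ (i + 1) ∣ b) (hb : b ≠ 0) :
    shiftedTopSeries r (m + 1) (2 ^ i + b) = X ^ 2 ^ i * shiftedTopSeries r m b := by
  simp only [shiftedTopSeries, popCount_two_pow_add h, Nat.add_le_add_iff_right,
    Nat.add_sub_add_right]
  split_ifs with hm
  · rw [topSeries, topSeries, log_two_pow_add h hb, ← mul_assoc, ← pow_add]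
    congr 2
    omega
  · simp

/-- The positive multiples of `2 ^ i` below `2 ^ r`. -/
def multiplesBelow (r i : ℕ) : Finset ℕ :=
  (Finset.range (2 ^ r)).filter fun b => b ≠ 0 ∧ 2 ^ i ∣ b

lemma mem_multiplesBelow {r i b : ℕ} :
    b ∈ multiplesBelow r i ↔ b < 2 ^ r ∧ b ≠ 0 ∧ 2 ^ i ∣ b := by
  simp [multiplesBelow]

lemma multiplesBelow_self (r : ℕ) : multiplesBelow r r = ∅ := by
  ext b
  simp only [mem_multiplesBelow, Finset.notMem_empty, iff_false]
  rintro ⟨h1, h2, h3⟩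
  exact absurd (Nat.le_of_dvd (Nat.pos_of_ne_zero h2) h3) (by omega)

lemma two_pow_add_lt {r i b : ℕ} (hi : i < r) (hb : b < 2 ^ r) (h : 2 ^ (i + 1) ∣ b) :
    2 ^ i + b < 2 ^ r := by
  obtain ⟨k, hk⟩ : 2 ^ (i + 1) ∣ 2 ^ r := pow_dvd_pow _ (by omega)
  obtain ⟨c, hc⟩ := h
  have hck : c + 1 ≤ k := by
    by_contra hlt
    have : 2 ^ (i + 1) * k ≤ 2 ^ (i + 1) * c := Nat.mul_le_mul_left _ (by omega)
    omega
  have h4 : 2 ^ (i + 1) * (c + 1) ≤ 2 ^ (i + 1) * k := Nat.mul_le_mul_left _ hck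
  have h5 : (2 : ℕ) ^ (i + 1) = 2 * 2 ^ i := by ring
  have h6 : 0 < (2 : ℕ) ^ i := by positivity
  rw [mul_add] at h4
  omega

lemma exists_of_not_dvd {i b : ℕ} (h : 2 ^ i ∣ b) (h' : ¬ 2 ^ (i + 1) ∣ b) :
    ∃ c, 2 ^ (i + 1) ∣ c ∧ b = 2 ^ i + c := by
  obtain ⟨k, rfl⟩ := h
  rcases Nat.even_or_odd' k with ⟨c, rfl | rfl⟩
  · exact absurd ⟨c, by ring⟩ h'
  · exact ⟨2 ^ (i + 1) * c, dvd_mul_right _ _, by ring⟩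

lemma not_dvd_two_pow_add {i c : ℕ} (h : 2 ^ (i + 1) ∣ c) : ¬ 2 ^ (i + 1) ∣ 2 ^ i + c := by
  intro h'
  have h2 := (Nat.dvd_add_left h).1 h'
  have := Nat.le_of_dvd (by positivity) h2
  have h5 : (2 : ℕ) ^ (i + 1) = 2 * 2 ^ i := by ring
  have h6 : 0 < (2 : ℕ) ^ i := by positivity
  omega

/-- A residue with lowest bit 2^i is either 2^i alone or 2^i plus a nonzero residue divisible by
2^(i+1). -/
lemma sum_multiplesBelow_sdiff {M : Type*} [AddCommMonoid M] {r i : ℕ} (hi : i < r) (f : ℕ → M) :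
    ∑ b ∈ (multiplesBelow r i).filter (fun b => ¬ 2 ^ (i + 1) ∣ b), f b
      = f (2 ^ i) + ∑ b ∈ multiplesBelow r (i + 1), f (2 ^ i + b) := by
  have h0 : (0 : ℕ) ∉ multiplesBelow r (i + 1) := by simp [mem_multiplesBelow]
  have : ∑ b ∈ insert 0 (multiplesBelow r (i + 1)), f (2 ^ i + b)
      = f (2 ^ i) + ∑ b ∈ multiplesBelow r (i + 1), f (2 ^ i + b) := by
    rw [Finset.sum_insert h0, Nat.add_zero]
  rw [← this]
  symm
  apply Finset.sum_bij (fun b _ => 2 ^ i + b)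
  · intro b hb
    have hb' : b < 2 ^ r ∧ 2 ^ (i + 1) ∣ b := by
      rcases Finset.mem_insert.1 hb with rfl | hb
      · exact ⟨by positivity, dvd_zero _⟩
      · exact ⟨(mem_multiplesBelow.1 hb).1, (mem_multiplesBelow.1 hb).2.2⟩
    have hpos : 0 < (2 : ℕ) ^ i := by positivity
    refine Finset.mem_filter.2 ⟨mem_multiplesBelow.2 ⟨two_pow_add_lt hi hb'.1 hb'.2, by omega, ?_⟩,
      not_dvd_two_pow_add hb'.2⟩
    exact dvd_add dvd_rfl ((pow_dvd_pow 2 (Nat.le_succ i)).trans hb'.2)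
  · intro b _ c _ h
    simpa using h
  · intro b hb
    obtain ⟨hb, hnd⟩ := Finset.mem_filter.1 hb
    obtain ⟨h1, h2, h3⟩ := mem_multiplesBelow.1 hb
    obtain ⟨c, hc, rfl⟩ := exists_of_not_dvd h3 hnd
    refine ⟨c, ?_, rfl⟩
    rcases Nat.eq_zero_or_pos c with rfl | hpos
    · exact Finset.mem_insert_self _ _
    · exact Finset.mem_insert_of_mem (mem_multiplesBelow.2 ⟨by omega, by omega, hc⟩)
  · intro b _
    rfl

lemma multiplesBelow_filter_dvd (r i : ℕ) :
    (multiplesBelow r i).filter (fun b => 2 ^ (i + 1) ∣ b) = multiplesBelow r (i + 1) := by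
  ext b
  simp only [Finset.mem_filter, mem_multiplesBelow]
  constructor
  · rintro ⟨⟨h1, h2, -⟩, h3⟩
    exact ⟨h1, h2, h3⟩
  · rintro ⟨h1, h2, h3⟩
    exact ⟨⟨h1, h2, (pow_dvd_pow 2 (Nat.le_succ i)).trans h3⟩, h3⟩

/-- The combinatorial reading of `tailPoly_rec`: induction on the level and, inside it, downward on
the colour. -/
lemma tailSeries_self_sub (r m i : ℕ) (hi : i ≤ r) :
    tailSeries r m r - tailSeries r m i = ∑ b ∈ multiplesBelow r i, shiftedTopSeries r m b := by
  induction m generalizing i with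
  | zero =>
    simp only [tailSeries, tailPoly, sub_self]
    symm
    apply Finset.sum_eq_zero
    intro b hb
    have := popCount_pos (mem_multiplesBelow.1 hb).2.1
    rw [shiftedTopSeries, if_neg (by omega)]
  | succ m ih =>
    induction hi using Nat.decreasingInduction with
    | self => simp [multiplesBelow_self]
    | of_succ i hi ihi =>
      -- Residues divisible by 2^(i+1) are covered by the inner induction. Among the others, 2^i
      -- alone gives the first new term of the recurrence; the rest, stripped of the bit 2^i, are
      -- summed by the induction on the level.
      rw [← Finset.sum_filter_add_sum_filter_not _ (fun b => 2 ^ (i + 1) ∣ b),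
        multiplesBelow_filter_dvd, ← ihi, sum_multiplesBelow_sdiff hi, shiftedTopSeries_two_pow,
        Finset.sum_congr rfl fun b hb => shiftedTopSeries_two_pow_add r m
          (mem_multiplesBelow.1 hb).2.2 (mem_multiplesBelow.1 hb).2.1,
        ← Finset.mul_sum, ← ih (i + 1) hi]
      have := tailPoly_rec ((X : ℤ⟦X⟧) ^ (2 ^ r - 1)) (fun i => X ^ 2 ^ i) m hi
      simp only [tailSeries, topSeries, Nat.log_pow (by norm_num : 1 < 2), pow_add, pow_mul] at this ⊢
      rw [this]
      ring

lemma tailSeries_succ_sub (r m i : ℕ) (hi : i < r) :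
    tailSeries r m (i + 1) - tailSeries r m i
      = ∑ b ∈ (multiplesBelow r i).filter (fun b => ¬ 2 ^ (i + 1) ∣ b), shiftedTopSeries r m b := by
  have h1 := tailSeries_self_sub r m i hi.le
  have h2 := tailSeries_self_sub r m (i + 1) hi
  rw [← Finset.sum_filter_add_sum_filter_not _ (fun b => 2 ^ (i + 1) ∣ b),
    multiplesBelow_filter_dvd] at h1
  linear_combination h1 - h2

/-- The level of the positive integer `x`. -/
def levelOf (r x : ℕ) : ℕ := (x - 1) / (2 ^ r - 1)

/-- The residue, in `[1, 2 ^ r - 1]`, of the positive integer `x`. -/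
def residueOf (r x : ℕ) : ℕ := (x - 1) % (2 ^ r - 1) + 1

/-- The index of the smallest element `(2 ^ r - 1) * m + 2 ^ i` that may follow `x`. -/
def nextIndex (r x : ℕ) : ℕ :=
  r * (levelOf r x + popCount (residueOf r x)) + padicValNat 2 (residueOf r x)

lemma levelOf_mul_add {r l b : ℕ} (hb : b ≠ 0) (hb' : b < 2 ^ r) :
    levelOf r ((2 ^ r - 1) * l + b) = l := by
  rw [levelOf, show (2 ^ r - 1) * l + b - 1 = (b - 1) + (2 ^ r - 1) * l by omega,
    Nat.add_mul_div_left _ _ (by omega), Nat.div_eq_of_lt (by omega), zero_add]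

lemma residueOf_mul_add {r l b : ℕ} (hb : b ≠ 0) (hb' : b < 2 ^ r) :
    residueOf r ((2 ^ r - 1) * l + b) = b := by
  rw [residueOf, show (2 ^ r - 1) * l + b - 1 = (b - 1) + (2 ^ r - 1) * l by omega,
    Nat.add_mul_mod_self_left, Nat.mod_eq_of_lt (by omega)]
  omega

lemma level_residue {x : ℕ} (r : ℕ) (hx : 1 ≤ x) :
    (2 ^ r - 1) * levelOf r x + residueOf r x = x := by
  have := Nat.div_add_mod (x - 1) (2 ^ r - 1)
  rw [levelOf, residueOf]
  omega

lemma residueOf_ne_zero (r x : ℕ) : residueOf r x ≠ 0 := by simp [residueOf]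

lemma residueOf_lt {r : ℕ} (hr : 1 ≤ r) (x : ℕ) : residueOf r x < 2 ^ r := by
  have h : 2 ≤ 2 ^ r := by
    calc 2 = 2 ^ 1 := rfl
      _ ≤ 2 ^ r := Nat.pow_le_pow_right (by norm_num) hr
  have := Nat.mod_lt (x - 1) (show 0 < 2 ^ r - 1 by omega)
  rw [residueOf]
  omega

lemma padicValNat_lt {r b : ℕ} (hb : b ≠ 0) (hb' : b < 2 ^ r) : padicValNat 2 b < r := by
  by_contra h
  have := (padicValNat_dvd_iff_le hb).2 (not_lt.1 h)
  exact absurd (Nat.le_of_dvd (Nat.pos_of_ne_zero hb) this) (by omega)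

/-- The generating function of the separated sets with largest element `x`. -/
noncomputable def maxSeries (r x : ℕ) : ℤ⟦X⟧ := topSeries r (levelOf r x) (residueOf r x)

lemma nextIndex_eq_iff {r : ℕ} (hr : 1 ≤ r) (x m i : ℕ) (hi : i < r) :
    nextIndex r x = r * m + i ↔ levelOf r x + popCount (residueOf r x) = m ∧
      2 ^ i ∣ residueOf r x ∧ ¬ 2 ^ (i + 1) ∣ residueOf r x := by
  have hv := padicValNat_lt (residueOf_ne_zero r x) (residueOf_lt hr x)
  rw [padicValNat_dvd_iff_le (residueOf_ne_zero r x), padicValNat_dvd_iff_le (residueOf_ne_zero r x)]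
  constructor
  · intro h
    have h1 : levelOf r x + popCount (residueOf r x) = m := by
      have := congrArg (· / r) h
      simpa [nextIndex, Nat.mul_add_div (by omega : 0 < r), Nat.div_eq_of_lt hv,
        Nat.div_eq_of_lt hi] using this
    rw [nextIndex, h1] at h
    omega
  · rintro ⟨rfl, h1, h2⟩
    rw [nextIndex]
    omega

/-- Given the index, the residue b determines the integer: its level must be m minus the bit count
of b. Every such integer is at most (2^r - 1) * m, so the precise value of T is immaterial. -/
lemma sum_shiftedTopSeries {r : ℕ} (hr : 1 ≤ r) (T m i : ℕ) (hi : i < r)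
    (hT : (2 ^ r - 1) * m ≤ T) :
    ∑ b ∈ (multiplesBelow r i).filter (fun b => ¬ 2 ^ (i + 1) ∣ b), shiftedTopSeries r m b
      = ∑ x ∈ (Finset.Icc 1 T).filter (fun x => nextIndex r x = r * m + i), maxSeries r x := by
  simp only [shiftedTopSeries]
  rw [← Finset.sum_filter]
  apply Finset.sum_bij' (fun b _ => (2 ^ r - 1) * (m - popCount b) + b) (fun x _ => residueOf r x)
  · intro b hb
    obtain ⟨hb, hpop⟩ := Finset.mem_filter.1 hb
    obtain ⟨hb, hnd⟩ := Finset.mem_filter.1 hb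
    obtain ⟨h1, h2, h3⟩ := mem_multiplesBelow.1 hb
    have hp := popCount_pos h2
    rw [Finset.mem_filter, nextIndex_eq_iff hr _ _ _ hi, levelOf_mul_add h2 h1,
      residueOf_mul_add h2 h1, Finset.mem_Icc]
    refine ⟨⟨by omega, ?_⟩, by omega, h3, hnd⟩
    calc (2 ^ r - 1) * (m - popCount b) + b
        ≤ (2 ^ r - 1) * (m - popCount b) + (2 ^ r - 1) * 1 := by omega
      _ = (2 ^ r - 1) * (m - popCount b + 1) := by ring
      _ ≤ (2 ^ r - 1) * m := Nat.mul_le_mul_left _ (by omega)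
      _ ≤ T := hT
  · intro x hx
    obtain ⟨hx, hidx⟩ := Finset.mem_filter.1 hx
    obtain ⟨h1, h2, h3⟩ := (nextIndex_eq_iff hr _ _ _ hi).1 hidx
    exact Finset.mem_filter.2 ⟨Finset.mem_filter.2 ⟨mem_multiplesBelow.2 ⟨residueOf_lt hr x,
      residueOf_ne_zero r x, h2⟩, h3⟩, by omega⟩
  · intro b hb
    obtain ⟨hb, hpop⟩ := Finset.mem_filter.1 hb
    obtain ⟨hb, hnd⟩ := Finset.mem_filter.1 hb
    obtain ⟨h1, h2, h3⟩ := mem_multiplesBelow.1 hb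
    exact residueOf_mul_add h2 h1
  · intro x hx
    obtain ⟨hx, hidx⟩ := Finset.mem_filter.1 hx
    obtain ⟨h1, h2, h3⟩ := (nextIndex_eq_iff hr _ _ _ hi).1 hidx
    rw [← h1, Nat.add_sub_cancel]
    exact level_residue r (Finset.mem_Icc.1 hx).1
  · intro b hb
    obtain ⟨hb, hpop⟩ := Finset.mem_filter.1 hb
    obtain ⟨hb, hnd⟩ := Finset.mem_filter.1 hb
    obtain ⟨h1, h2, h3⟩ := mem_multiplesBelow.1 hb
    rw [maxSeries, levelOf_mul_add h2 h1, residueOf_mul_add h2 h1]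

/-- Telescoping over the index: each step in the colour adds the largest elements of exactly one
index, and colour 0 of a level agrees with colour r of the level before. The summand 1 is the empty
set. -/
lemma tailSeries_eq_sum {r : ℕ} (hr : 1 ≤ r) (T m i : ℕ) (hi : i ≤ r)
    (hT : (2 ^ r - 1) * m ≤ T) :
    tailSeries r m i
      = 1 + ∑ x ∈ (Finset.Icc 1 T).filter (fun x => nextIndex r x < r * m + i), maxSeries r x := by
  induction m generalizing i with
  | zero =>
    rw [Finset.filter_false_of_mem]
    · simp [tailSeries, tailPoly]
    · intro x _
      have := popCount_pos (residueOf_ne_zero r x)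
      have : r * 1 ≤ r * (levelOf r x + popCount (residueOf r x)) :=
        Nat.mul_le_mul_left _ (by omega)
      rw [nextIndex]
      omega
  | succ m ih =>
    induction i with
    | zero =>
      have h0 : tailSeries r (m + 1) 0 = tailSeries r m r := tailPoly_succ_zero _ _ r m
      rw [h0, ih r le_rfl (le_trans (Nat.mul_le_mul_left _ (Nat.le_succ m)) hT)]
      simp only [Nat.mul_succ, Nat.add_zero]
    | succ i ihi =>
      have h1 := tailSeries_succ_sub r (m + 1) i hi
      rw [sum_shiftedTopSeries hr T (m + 1) i hi hT] at h1
      rw [sub_eq_iff_eq_add.1 h1, ihi (by omega), add_left_comm, ← Finset.sum_union]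
      · congr 2
        ext x
        simp only [Finset.mem_union, Finset.mem_filter]
        constructor
        · rintro (⟨h, h'⟩ | ⟨h, h'⟩) <;> exact ⟨h, by omega⟩
        · rintro ⟨h, h'⟩
          by_cases h'' : nextIndex r x = r * (m + 1) + i
          · exact Or.inl ⟨h, h''⟩
          · exact Or.inr ⟨h, by omega⟩
      · rw [Finset.disjoint_left]
        intro x h h'
        have := (Finset.mem_filter.1 h).2
        have := (Finset.mem_filter.1 h').2
        omega

/-- Two levels of difference suffice for any residues. With one level of difference the residue of z
has a single bit, which is at most the leading bit of the residue of x, so the residues are in the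
right order. -/
lemma add_le_of_nextIndex {r : ℕ} (hr : 1 ≤ r) {x z : ℕ} (hx : 1 ≤ x) (hz : 1 ≤ z)
    (h : nextIndex r z < r * levelOf r x + (Nat.log 2 (residueOf r x) + 1)) :
    z + (2 ^ r - 1) ≤ x := by
  have ex := level_residue r hx
  have ez := level_residue r hz
  have hbx := residueOf_lt hr x
  have hbz := residueOf_lt hr z
  have hx0 := residueOf_ne_zero r x
  have hz0 := residueOf_ne_zero r z
  have hp := popCount_pos hz0
  have hlog : Nat.log 2 (residueOf r x) < r := Nat.log_lt_of_lt_pow hx0 hbx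
  rw [nextIndex] at h
  set l := levelOf r x
  set b := residueOf r x
  set l' := levelOf r z
  set b' := residueOf r z
  set N := 2 ^ r - 1
  have hle : l' + popCount b' ≤ l := by
    by_contra hlt
    have : r * (l + 1) ≤ r * (l' + popCount b') := Nat.mul_le_mul_left _ (by omega)
    rw [Nat.mul_succ] at this
    omega
  by_cases h2 : l' + 2 ≤ l
  · have : N * (l' + 2) ≤ N * l := Nat.mul_le_mul_left _ h2
    rw [mul_add] at this
    omega
  · have hl : l = l' + 1 := by omega
    have hpop : popCount b' = 1 := by omega
    have hb' : b' = 2 ^ padicValNat 2 b' := by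
      have hnd : ¬ 2 ^ (padicValNat 2 b' + 1) ∣ b' := by
        rw [padicValNat_dvd_iff_le hz0]; omega
      obtain ⟨c, hc, hbc⟩ := exists_of_not_dvd ((padicValNat_dvd_iff_le hz0).2 le_rfl) hnd
      rcases Nat.eq_zero_or_pos c with h0 | h0
      · rw [h0] at hbc
        exact hbc
      · have := popCount_pos h0.ne'
        rw [hbc, popCount_two_pow_add hc] at hpop
        omega
    have hv : padicValNat 2 b' ≤ Nat.log 2 b := by
      rw [hl, hpop] at h
      omega
    have : b' ≤ b := by
      rw [hb']
      exact (Nat.pow_le_pow_right (by norm_num) hv).trans (Nat.pow_log_le_self 2 hx0)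
    have e : N * l = N * l' + N := by rw [hl]; ring
    omega

/-- Below the largest element x there is nothing, or a set whose own largest element is at distance
at least 2^r - 1. This recursion is all that the counting needs. -/
lemma maxSeries_eq {r : ℕ} (hr : 1 ≤ r) {x : ℕ} (hx : 1 ≤ x) :
    ∃ F ⊆ Finset.Icc 1 (x - (2 ^ r - 1)),
      maxSeries r x = X ^ x * (1 + ∑ z ∈ F, maxSeries r z) := by
  have hlog : Nat.log 2 (residueOf r x) < r :=
    Nat.log_lt_of_lt_pow (residueOf_ne_zero r x) (residueOf_lt hr x)
  refine ⟨(Finset.Icc 1 ((2 ^ r - 1) * levelOf r x)).filter fun z =>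
    nextIndex r z < r * levelOf r x + (Nat.log 2 (residueOf r x) + 1), ?_, ?_⟩
  · intro z hz
    obtain ⟨hz, hidx⟩ := Finset.mem_filter.1 hz
    have hz := (Finset.mem_Icc.1 hz).1
    have := add_le_of_nextIndex hr hx hz hidx
    rw [Finset.mem_Icc]
    omega
  · rw [maxSeries, topSeries, level_residue r hx, tailSeries_eq_sum hr _ _ _ hlog le_rfl]

lemma coeff_maxSeries_nonneg {r : ℕ} (hr : 1 ≤ r) {x : ℕ} (hx : 1 ≤ x) (n : ℕ) :
    0 ≤ coeff n (maxSeries r x) := by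
  induction x using Nat.strong_induction_on generalizing n with
  | _ x ih =>
    have hN : 1 ≤ 2 ^ r - 1 := by
      have := Nat.pow_le_pow_right (show 0 < 2 by norm_num) hr
      omega
    obtain ⟨F, hF, h⟩ := maxSeries_eq hr hx
    rw [h, coeff_X_pow_mul']
    split_ifs with hxn
    · rw [map_add, map_sum]
      apply add_nonneg
      · rw [coeff_one]; split_ifs <;> norm_num
      · apply Finset.sum_nonneg
        intro z hz
        have := Finset.mem_Icc.1 (hF hz)
        exact ih z (by omega) this.1 _
    · exact le_rfl

/-- Only an inequality, since the admissible second elements may form a proper subset of those at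
distance at least 2^r - 1; the omitted series have nonnegative coefficients. -/
lemma coeff_sum_maxSeries_le {r : ℕ} (hr : 1 ≤ r) (x n : ℕ) :
    coeff n (1 + ∑ z ∈ Finset.Icc 1 x, maxSeries r z) ≤ ((sepSets (2 ^ r - 1) x n).card : ℤ) := by
  have hN : 1 ≤ 2 ^ r - 1 := by
    have := Nat.pow_le_pow_right (show 0 < 2 by norm_num) hr
    omega
  induction x using Nat.strong_induction_on generalizing n with
  | _ x ih =>
    rcases x with _ | x
    · simp only [Finset.Icc_eq_empty_of_lt Nat.zero_lt_one, Finset.sum_empty, add_zero, coeff_one]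
      split_ifs with h
      · have : ∅ ∈ sepSets (2 ^ r - 1) 0 n := mem_sepSets.2 ⟨by simp, by simp, by simp [h]⟩
        exact_mod_cast Finset.card_pos.2 ⟨_, this⟩
      · positivity
    · rw [Finset.sum_Icc_succ_top (by omega), ← add_assoc, map_add]
      have h1 := ih x (by omega) n
      obtain ⟨F, hF, h⟩ := maxSeries_eq hr (by omega : 1 ≤ x + 1)
      rw [h, coeff_X_pow_mul']
      split_ifs with hxn
      · have h2 := ih (x + 1 - (2 ^ r - 1)) (by omega) (n - (x + 1))
        have h3 : coeff (n - (x + 1)) (1 + ∑ z ∈ F, maxSeries r z)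
            ≤ coeff (n - (x + 1)) (1 + ∑ z ∈ Finset.Icc 1 (x + 1 - (2 ^ r - 1)), maxSeries r z) := by
          rw [map_add, map_add, map_sum, map_sum]
          refine add_le_add le_rfl ?_
          apply Finset.sum_le_sum_of_subset_of_nonneg hF
          intro z hz _
          exact coeff_maxSeries_nonneg hr (Finset.mem_Icc.1 hz).1 _
        have h4 := card_sepSets_succ (2 ^ r - 1) x n hN hxn
        zify at h4
        linarith
      · have := Finset.card_le_card (sepSets_mono (2 ^ r - 1) n (Nat.le_succ x))
        zify at this
        linarith

/-- The number of partitions of `n` into distinct parts congruent to a power of two below `2 ^ r`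
modulo `2 ^ r - 1` is at most the number of separated sets of sum `n`. -/
theorem coeff_prod_le_card_sepSets {r : ℕ} (hr : 1 ≤ r) (n : ℕ) :
    coeff n (∏ i ∈ Finset.range r, ∏ l ∈ Finset.range ((r + 1) * (n + 1)),
      (1 + (X : ℤ⟦X⟧) ^ ((2 ^ r - 1) * l + 2 ^ i))) ≤
      ((sepSets (2 ^ r - 1) n n).card : ℤ) := by
  have hN : 1 ≤ 2 ^ r - 1 := by
    have := Nat.pow_le_pow_right (show 0 < 2 by norm_num) hr
    omega
  set m := (r + 1) * (n + 1) with hm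
  have h1 := levelPoly_congr_prod (2 ^ r - 1) hN (fun i => 2 ^ i) (fun i => Nat.one_le_two_pow)
    r n m le_rfl
  have h2 := X_pow_dvd_iff.1 h1 n (Nat.lt_succ_self n)
  rw [map_sub, sub_eq_zero] at h2
  have h3 : ∏ i ∈ Finset.range r, ∏ l ∈ Finset.range m,
      (1 + (X : ℤ⟦X⟧) ^ ((2 ^ r - 1) * l + 2 ^ i))
      = ∏ i ∈ Finset.range r, ∏ l ∈ Finset.range m,
        (1 + (X : ℤ⟦X⟧) ^ 2 ^ i * (X ^ (2 ^ r - 1)) ^ l) := by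
    refine Finset.prod_congr rfl fun i _ => Finset.prod_congr rfl fun l _ => ?_
    rw [← pow_mul, ← pow_add, add_comm (2 ^ i)]
  rw [h3, ← h2]
  have h4 : levelPoly ((X : ℤ⟦X⟧) ^ (2 ^ r - 1)) (fun i => X ^ 2 ^ i) r m
      = tailSeries r (m + 1) 0 := by
    rw [tailSeries, tailPoly, colourPoly_zero]
  rw [h4, tailSeries_eq_sum hr ((2 ^ r - 1) * (m + 1)) _ _ (Nat.zero_le r) le_rfl]
  set T := (2 ^ r - 1) * (m + 1)
  calc _ ≤ (coeff n (1 + ∑ z ∈ Finset.Icc 1 T, maxSeries r z) : ℤ) := by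
        rw [map_add, map_add, map_sum, map_sum]
        refine add_le_add le_rfl ?_
        apply Finset.sum_le_sum_of_subset_of_nonneg (Finset.filter_subset _ _)
        intro z hz _
        exact coeff_maxSeries_nonneg hr (Finset.mem_Icc.1 hz).1 _
    _ ≤ ((sepSets (2 ^ r - 1) T n).card : ℤ) := coeff_sum_maxSeries_le hr T n
    _ ≤ ((sepSets (2 ^ r - 1) n n).card : ℤ) := by
        norm_cast
        apply Finset.card_le_card
        intro s hs
        obtain ⟨h1, h2, h3⟩ := mem_sepSets.1 hs
        refine mem_sepSets.2 ⟨fun u hu => ⟨(h1 u hu).1, ?_⟩, h2, h3⟩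
        rw [← h3]
        exact Finset.single_le_sum (f := fun u => u) (fun _ _ => Nat.zero_le _) hu

end Andrews

/-! ### Euler's binary splitting of multiplicities. -/

section Euler

open PowerSeries

/-- Odd integers congruent to a power of two, below `2 ^ r`, modulo `2 ^ r - 1`. -/
def IsOddPower (r x : ℕ) : Prop := Odd x ∧ ∃ i < r, x % (2 ^ r - 1) = 2 ^ i

lemma two_pow_lt_modulus {r i : ℕ} (hr : 2 ≤ r) (hi : i < r) : 2 ^ i < 2 ^ r - 1 := by
  obtain ⟨s, rfl⟩ : ∃ s, r = s + 1 := ⟨r - 1, by omega⟩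
  have h1 : 2 ^ i ≤ 2 ^ s := Nat.pow_le_pow_right (by norm_num) (by omega)
  have h2 : 2 ^ 1 ≤ 2 ^ s := Nat.pow_le_pow_right (by norm_num) (by omega)
  rw [pow_succ]
  omega

/-- Doubling permutes the powers of two cyclically modulo 2^r - 1, because 2^r is congruent to 1. -/
lemma exists_mod_two_pow_mul {r x : ℕ} (hr : 2 ≤ r) (h : ∃ i < r, x % (2 ^ r - 1) = 2 ^ i) (j : ℕ) :
    ∃ i < r, (2 ^ j * x) % (2 ^ r - 1) = 2 ^ i := by
  induction j with
  | zero => simpa using h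
  | succ j ih =>
    obtain ⟨i, hi, h⟩ := ih
    have h1 := two_pow_lt_modulus hr (by omega : 0 < r)
    have e : (2 ^ (j + 1) * x) % (2 ^ r - 1) = 2 ^ (i + 1) % (2 ^ r - 1) := by
      rw [pow_succ', mul_assoc, Nat.mul_mod, h, pow_succ']
      exact Nat.mod_mul_mod _ _ _
    rcases Nat.lt_or_ge (i + 1) r with h2 | h2
    · exact ⟨i + 1, h2, by rw [e, Nat.mod_eq_of_lt (two_pow_lt_modulus hr h2)]⟩
    · refine ⟨0, by omega, ?_⟩
      obtain rfl : i + 1 = r := by omega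
      rw [e]
      nth_rewrite 1 [show 2 ^ (i + 1) = 1 + (2 ^ (i + 1) - 1) by omega]
      rw [Nat.add_mod_right, Nat.mod_eq_of_lt (by simpa using h1), pow_zero]

/-- The integer of colour `q.1` and level `q.2`. -/
def colouredInt (r : ℕ) (q : ℕ × ℕ) : ℕ := (2 ^ r - 1) * q.2 + 2 ^ q.1

/-- The colour and the level of an integer. -/
def colourLevel (r e : ℕ) : ℕ × ℕ := (Nat.log 2 (e % (2 ^ r - 1)), e / (2 ^ r - 1))

lemma colourLevel_colouredInt {r : ℕ} (hr : 2 ≤ r) {q : ℕ × ℕ} (hq : q.1 < r) :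
    colourLevel r (colouredInt r q) = q := by
  have h := two_pow_lt_modulus hr hq
  rw [colourLevel, colouredInt, Nat.mul_add_mod, Nat.mod_eq_of_lt h,
    Nat.log_pow (by norm_num), Nat.mul_add_div ((Nat.zero_le _).trans_lt h), Nat.div_eq_of_lt h]
  rfl

lemma colouredInt_colourLevel {r e : ℕ} (h : ∃ i < r, e % (2 ^ r - 1) = 2 ^ i) :
    colouredInt r (colourLevel r e) = e := by
  obtain ⟨i, hi, h⟩ := h
  have := Nat.div_add_mod e (2 ^ r - 1)
  simp only [colourLevel, colouredInt, h, Nat.log_pow (by norm_num : 1 < 2)] at this ⊢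
  exact this

lemma colourLevel_mem {r e n m : ℕ} (h : ∃ i < r, e % (2 ^ r - 1) = 2 ^ i) (he : e ≤ n)
    (hm : n < m) : colourLevel r e ∈ Finset.range r ×ˢ Finset.range m := by
  obtain ⟨i, hi, h⟩ := h
  rw [colourLevel, h, Nat.log_pow (by norm_num), Finset.mem_product, Finset.mem_range,
    Finset.mem_range]
  exact ⟨hi, (Nat.div_le_self _ _).trans_lt (he.trans_lt hm)⟩

lemma ordCompl_two_pow_mul {x : ℕ} (hx : Odd x) (j : ℕ) :
    padicValNat 2 (2 ^ j * x) = j ∧ 2 ^ j * x / 2 ^ j = x := by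
  constructor
  · rw [padicValNat.mul (by positivity) hx.pos.ne', padicValNat.prime_pow,
      padicValNat.eq_zero_of_not_dvd (Nat.two_dvd_ne_zero.2 (Nat.odd_iff.1 hx)), Nat.add_zero]
  · exact Nat.mul_div_cancel_left _ (by positivity)

lemma coeff_prod_one_add (r m n : ℕ) :
    coeff n (∏ i ∈ Finset.range r, ∏ l ∈ Finset.range m,
      (1 + (X : ℤ⟦X⟧) ^ ((2 ^ r - 1) * l + 2 ^ i)))
      = (((Finset.range r ×ˢ Finset.range m).powerset.filter
          fun t => ∑ q ∈ t, colouredInt r q = n).card : ℤ) := by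
  rw [← Finset.prod_product' (f := fun i l => 1 + (X : ℤ⟦X⟧) ^ ((2 ^ r - 1) * l + 2 ^ i)),
    Finset.prod_one_add, map_sum, Finset.card_filter, Nat.cast_sum]
  refine Finset.sum_congr rfl fun t _ => ?_
  rw [Finset.prod_pow_eq_pow_sum, coeff_X_pow]
  change (if n = ∑ q ∈ t, colouredInt r q then (1 : ℤ) else 0) = _
  by_cases h : ∑ q ∈ t, colouredInt r q = n
  · rw [if_pos h, if_pos h.symm, Nat.cast_one]
  · rw [if_neg h, if_neg (Ne.symm h), Nat.cast_zero]

/-- The set of the integers `2 ^ j * x` where `2 ^ j` occurs in the binary expansion of the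
multiplicity of `x`, as pairs of a colour and a level. -/
def binarySet (r m : ℕ) (s : Multiset ℕ) : Finset (ℕ × ℕ) :=
  (Finset.range r ×ˢ Finset.range m).filter fun q =>
    (s.count (colouredInt r q / 2 ^ padicValNat 2 (colouredInt r q))).testBit
      (padicValNat 2 (colouredInt r q))

lemma count_mul_le_sum (s : Multiset ℕ) (x : ℕ) : s.count x * x ≤ s.sum := by
  rw [Finset.sum_multiset_count]
  rcases Nat.eq_zero_or_pos (s.count x) with h | h
  · simp [h]
  · exact Finset.single_le_sum (f := fun x => s.count x • x) (fun _ _ => Nat.zero_le _)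
      (Multiset.mem_toFinset.2 (Multiset.count_pos.1 h))

lemma two_pow_mul_le_sum {s : Multiset ℕ} {x j : ℕ} (h : (s.count x).testBit j) :
    2 ^ j * x ≤ s.sum :=
  (Nat.mul_le_mul_right x (Nat.ge_two_pow_of_testBit h)).trans (count_mul_le_sum s x)

/-- As x is odd, 2^j * x determines both x and j. The set therefore records every binary digit of
every multiplicity, which makes the construction injective. -/
lemma mem_binarySet {r m : ℕ} (hr : 2 ≤ r) {s : Multiset ℕ} (hm : s.sum < m) {x j : ℕ}
    (hx : IsOddPower r x) :
    colourLevel r (2 ^ j * x) ∈ binarySet r m s ↔ (s.count x).testBit j := by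
  have h := exists_mod_two_pow_mul hr hx.2 j
  obtain ⟨h1, h2⟩ := ordCompl_two_pow_mul hx.1 j
  rw [binarySet, Finset.mem_filter, colouredInt_colourLevel h, h1, h2]
  exact ⟨fun h => h.2, fun h3 => ⟨colourLevel_mem h (two_pow_mul_le_sum h3) hm, h3⟩⟩

lemma sum_binarySet {r m : ℕ} (hr : 2 ≤ r) {s : Multiset ℕ} (hm : s.sum < m)
    (hs : ∀ x ∈ s, IsOddPower r x) : ∑ q ∈ binarySet r m s, colouredInt r q = s.sum := by
  have e : s.sum = ∑ z ∈ s.toFinset.sigma fun x => (s.count x).bitIndices.toFinset,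
      2 ^ z.2 * z.1 := by
    rw [Finset.sum_sigma, Finset.sum_multiset_count]
    refine Finset.sum_congr rfl fun x _ => ?_
    rw [← Finset.sum_mul, Finset.sum_toFinset_bitIndices_two_pow, smul_eq_mul]
  rw [e]
  symm
  refine Finset.sum_bij' (fun z _ => colourLevel r (2 ^ z.2 * z.1))
    (fun q _ => ⟨colouredInt r q / 2 ^ padicValNat 2 (colouredInt r q),
      padicValNat 2 (colouredInt r q)⟩) ?_ ?_ ?_ ?_ ?_
  · rintro ⟨x, j⟩ hz
    simp only [Finset.mem_sigma, Multiset.mem_toFinset, List.mem_toFinset, Nat.mem_bitIndices] at hz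
    exact (mem_binarySet hr hm (hs x hz.1)).2 hz.2
  · intro q hq
    have := (Finset.mem_filter.1 hq).2
    simp only [Finset.mem_sigma, Multiset.mem_toFinset, List.mem_toFinset, Nat.mem_bitIndices]
    refine ⟨?_, this⟩
    rw [← Multiset.count_ne_zero]
    intro h0
    simp [h0] at this
  · rintro ⟨x, j⟩ hz
    simp only [Finset.mem_sigma, Multiset.mem_toFinset, List.mem_toFinset, Nat.mem_bitIndices] at hz
    have h := exists_mod_two_pow_mul hr (hs x hz.1).2 j
    obtain ⟨h1, h2⟩ := ordCompl_two_pow_mul (hs x hz.1).1 j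
    simp only [colouredInt_colourLevel h, h1, h2]
  · intro q hq
    have hq := (Finset.mem_product.1 (Finset.mem_filter.1 hq).1).1
    simp only
    rw [Nat.mul_div_cancel' pow_padicValNat_dvd, colourLevel_colouredInt hr (Finset.mem_range.1 hq)]
  · rintro ⟨x, j⟩ hz
    simp only [Finset.mem_sigma, Multiset.mem_toFinset, List.mem_toFinset, Nat.mem_bitIndices] at hz
    rw [colouredInt_colourLevel (exists_mod_two_pow_mul hr (hs x hz.1).2 j)]

lemma binarySet_injOn {r m n : ℕ} (hr : 2 ≤ r) (hm : n < m) {s t : Multiset ℕ}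
    (hs : ∀ x ∈ s, IsOddPower r x) (ht : ∀ x ∈ t, IsOddPower r x) (hsn : s.sum = n)
    (htn : t.sum = n) (h : binarySet r m s = binarySet r m t) : s = t := by
  ext x
  by_cases hx : IsOddPower r x
  · apply Nat.eq_of_testBit_eq
    intro j
    rw [Bool.eq_iff_iff, ← mem_binarySet hr (hsn ▸ hm) hx, h, mem_binarySet hr (htn ▸ hm) hx]
  · rw [Multiset.count_eq_zero_of_notMem fun h => hx (hs x h),
      Multiset.count_eq_zero_of_notMem fun h => hx (ht x h)]

/-- Partitions into odd parts congruent to a power of two modulo `2 ^ r - 1` are at most as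
numerous as the separated sets. -/
theorem card_oddPower_le_card_sepSets {r : ℕ} (hr : 2 ≤ r) (n : ℕ) (A : Finset (Multiset ℕ))
    (hA : ∀ s ∈ A, s.sum = n ∧ ∀ x ∈ s, IsOddPower r x) :
    A.card ≤ (sepSets (2 ^ r - 1) n n).card := by
  have h1 := coeff_prod_le_card_sepSets (by omega : 1 ≤ r) n
  rw [coeff_prod_one_add] at h1
  have hm : n < (r + 1) * (n + 1) := by nlinarith
  refine le_trans ?_ (Nat.cast_le.1 h1)
  apply Finset.card_le_card_of_injOn (binarySet r ((r + 1) * (n + 1)))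
  · intro s hs
    obtain ⟨hsn, hs⟩ := hA s hs
    rw [Finset.mem_coe, Finset.mem_filter, Finset.mem_powerset]
    exact ⟨Finset.filter_subset _ _, by rw [sum_binarySet hr (hsn ▸ hm) hs, hsn]⟩
  · intro s hs t ht h
    exact binarySet_injOn hr hm (hA s hs).2 (hA t ht).2 (hA s hs).1 (hA t ht).1 h

end Euler

/-! ### From gaps 31 to gaps d, and from sets to partitions. -/

section Transfer

lemma insert_eq_insert_of_lt {a b : ℕ} {A B : Finset ℕ} (hA : ∀ u ∈ A, u < a)
    (hB : ∀ u ∈ B, u < b) (h : insert a A = insert b B) : a = b ∧ A = B := by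
  have hab : a = b := by
    have h1 : a ∈ insert b B := h ▸ Finset.mem_insert_self a A
    have h2 : b ∈ insert a A := h ▸ Finset.mem_insert_self b B
    rcases Finset.mem_insert.1 h1 with h1 | h1
    · exact h1
    · rcases Finset.mem_insert.1 h2 with h2 | h2
      · exact h2.symm
      · exact absurd (hA b h2) (hB a h1).asymm
  subst hab
  refine ⟨rfl, ?_⟩
  have := congrArg (fun u => u.erase a) h
  simpa [Finset.erase_insert fun h => (hA a h).false, Finset.erase_insert fun h => (hB a h).false]
    using this

/-- Stretches the levels of length `31` to levels of length `d`. -/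
def stretch (d u : ℕ) : ℕ := u + (d - 31) * ((u - 1) / 31)

lemma stretch_add_le {d u v : ℕ} (hd : 31 ≤ d) (hu : 1 ≤ u) (h : u + 31 ≤ v) :
    stretch d u + d ≤ stretch d v := by
  obtain ⟨e, rfl⟩ : ∃ e, d = 31 + e := ⟨d - 31, by omega⟩
  have h1 : (u - 1) / 31 + 1 ≤ (v - 1) / 31 := by omega
  have h2 := Nat.mul_le_mul_left e h1
  rw [mul_add] at h2
  simp only [stretch, Nat.add_sub_cancel_left]
  omega

lemma stretch_strictMono (d : ℕ) : StrictMono (stretch d) := by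
  intro u v h
  have h1 : (u - 1) / 31 ≤ (v - 1) / 31 := by omega
  have h2 := Nat.mul_le_mul_left (d - 31) h1
  simp only [stretch]
  omega

/-- All elements but the largest are stretched, and the largest is chosen to make the sum `n`. -/
def stretchSet (d n : ℕ) (s : Finset ℕ) : Finset ℕ :=
  insert (n - ∑ u ∈ s.erase (s.sup id), stretch d u) ((s.erase (s.sup id)).image (stretch d))

lemma sup_mem_of_sum_pos {s : Finset ℕ} (h : ∑ u ∈ s, u ≠ 0) : s.sup id ∈ s := by
  have hne : s.Nonempty := Finset.nonempty_of_sum_ne_zero h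
  obtain ⟨x, hx, he⟩ := Finset.exists_mem_eq_sup s hne id
  rw [he]
  exact hx

/-- Room for the new largest element: it must exceed every stretched element by d. Stretching adds d
- 31 per level, so the levels have to be bounded in terms of K. -/
lemma sum_stretch_add_le {d n K δ : ℕ} (hd : 31 ≤ d) (hδ : δ = 1 ∨ δ = 2) (hn : d * K + δ ≤ n)
    {s : Finset ℕ} (hs : s ∈ sepSets 31 (31 * K + δ) (31 * K + δ)) {u : ℕ}
    (hu : u ∈ s.erase (s.sup id)) :
    ∑ v ∈ s.erase (s.sup id), stretch d v + stretch d u + d ≤ n := by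
  obtain ⟨h1, h2, h3⟩ := mem_sepSets.1 hs
  obtain ⟨e, rfl⟩ : ∃ e, d = 31 + e := ⟨d - 31, by omega⟩
  have hmax : s.sup id ∈ s := sup_mem_of_sum_pos (by rw [h3]; omega)
  have hus := Finset.mem_of_mem_erase hu
  have hlt : u < s.sup id :=
    lt_of_le_of_ne (Finset.le_sup (f := id) hus) (Finset.ne_of_mem_erase hu)
  have h4 := h2 u hus _ hmax hlt
  have h5 : ∑ v ∈ s.erase (s.sup id), v + s.sup id = 31 * K + δ := by
    rw [Finset.sum_erase_add _ _ hmax, h3]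
  set t := s.erase (s.sup id) with ht
  have h6 : ∑ v ∈ t, (31 * ((v - 1) / 31) + 1) ≤ ∑ v ∈ t, v := by
    apply Finset.sum_le_sum
    intro v hv
    have := (h1 v (Finset.mem_of_mem_erase hv)).1
    omega
  rw [Finset.sum_add_distrib, ← Finset.mul_sum, Finset.sum_const, smul_eq_mul, mul_one] at h6
  have h7 : 1 ≤ t.card := Finset.card_pos.2 ⟨u, hu⟩
  have hu1 := (h1 u hus).1
  simp only [stretch, Nat.add_sub_cancel_left, Finset.sum_add_distrib, ← Finset.mul_sum]
  set L := ∑ v ∈ t, (v - 1) / 31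
  -- The old maximum is at least u + 31, and both u and the sum of the remaining elements exceed 31
  -- times their levels by at least 1. The left side times 31, plus 2, is thus at most 31 * K + δ;
  -- here δ ≤ 2 is essential.
  have h8 : L + (u - 1) / 31 + 1 ≤ K := by omega
  have h9 := Nat.mul_le_mul_left e h8
  rw [mul_add, mul_add] at h9
  rw [add_mul] at hn
  omega

/-- The new maximum exceeds all stretched elements, so the image determines the latter and hence the
old non-maximal elements. The fixed sum 31 * K + δ then recovers the old maximum. -/
theorem card_sepSets_stretch {d n K δ : ℕ} (hd : 31 ≤ d) (hδ : δ = 1 ∨ δ = 2)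
    (hn : d * K + δ ≤ n) :
    (sepSets 31 (31 * K + δ) (31 * K + δ)).card ≤ (sepSets d n n).card := by
  have hlt : ∀ s ∈ sepSets 31 (31 * K + δ) (31 * K + δ),
      ∀ u ∈ (s.erase (s.sup id)).image (stretch d),
        u + d ≤ n - ∑ u ∈ s.erase (s.sup id), stretch d u := by
    intro s hs u hu
    obtain ⟨v, hv, rfl⟩ := Finset.mem_image.1 hu
    have := sum_stretch_add_le hd hδ hn hs hv
    omega
  have hinj := (stretch_strictMono d).injective
  apply Finset.card_le_card_of_injOn (stretchSet d n)
  · intro s hs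
    have hlt := hlt s hs
    have hsum : ∑ u ∈ s.erase (s.sup id), stretch d u < n := by
      rcases (s.erase (s.sup id)).eq_empty_or_nonempty with h | ⟨u, hu⟩
      · rw [h, Finset.sum_empty]; omega
      · have := sum_stretch_add_le hd hδ hn hs hu
        omega
    obtain ⟨h1, h2, h3⟩ := mem_sepSets.1 hs
    refine mem_sepSets.2 ⟨?_, ?_, ?_⟩
    · intro u hu
      rcases Finset.mem_insert.1 hu with rfl | hu
      · omega
      · have h5 := hlt u hu
        obtain ⟨v, hv, rfl⟩ := Finset.mem_image.1 hu
        have := (h1 v (Finset.mem_of_mem_erase hv)).1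
        refine ⟨?_, by omega⟩
        rw [stretch]
        omega
    · intro u hu v hv huv
      rcases Finset.mem_insert.1 hu with rfl | hu <;> rcases Finset.mem_insert.1 hv with rfl | hv
      · omega
      · have := hlt v hv; omega
      · exact hlt u hu
      · obtain ⟨u', hu', rfl⟩ := Finset.mem_image.1 hu
        obtain ⟨v', hv', rfl⟩ := Finset.mem_image.1 hv
        have hu' := Finset.mem_of_mem_erase hu'
        exact stretch_add_le hd (h1 u' hu').1 (h2 u' hu' v' (Finset.mem_of_mem_erase hv')
          ((stretch_strictMono d).lt_iff_lt.1 huv))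
    · rw [stretchSet, Finset.sum_insert, Finset.sum_image hinj.injOn]
      · omega
      · intro h
        have := hlt _ h
        omega
  · intro s hs t ht h
    obtain ⟨-, h2⟩ := insert_eq_insert_of_lt (fun u hu => by have := hlt s hs u hu; omega)
      (fun u hu => by have := hlt t ht u hu; omega) h
    have h3 := Finset.image_injective hinj h2
    have hs3 := (mem_sepSets.1 hs).2.2
    have ht3 := (mem_sepSets.1 ht).2.2
    have hsm : s.sup id ∈ s := sup_mem_of_sum_pos (by rw [hs3]; omega)
    have htm : t.sup id ∈ t := sup_mem_of_sum_pos (by rw [ht3]; omega)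
    have hs4 := Finset.sum_erase_add s (fun u => u) hsm
    have ht4 := Finset.sum_erase_add t (fun u => u) htm
    have h4 : s.sup id = t.sup id := by
      rw [h3] at hs4
      omega
    rw [← Finset.insert_erase hsm, ← Finset.insert_erase htm, h3, h4]

theorem card_sepSets_le_diffPartitionCount (d n : ℕ) :
    (sepSets d n n).card ≤ diffPartitionCount d 1 n := by
  rw [diffPartitionCount]
  calc (sepSets d n n).card = ((sepSets d n n).image Finset.val).card :=
        (Finset.card_image_of_injective _ Finset.val_injective).symm
    _ ≤ ((Finset.univ.filter fun p : n.Partition => (∀ x ∈ p.parts, 1 ≤ x) ∧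
          (p.parts.sort (· ≤ ·)).Pairwise fun x y => x + d ≤ y).image
            Nat.Partition.parts).card := by
        apply Finset.card_le_card
        intro m hm
        obtain ⟨s, hs, rfl⟩ := Finset.mem_image.1 hm
        obtain ⟨h1, h2, h3⟩ := mem_sepSets.1 hs
        refine Finset.mem_image.2 ⟨⟨s.val, fun {i} hi => (h1 i hi).1, ?_⟩, ?_, rfl⟩
        · rw [← h3, Finset.sum, Multiset.map_id']
        · simp only [Finset.mem_filter, Finset.mem_univ, true_and]
          refine ⟨fun x hx => (h1 x hx).1, ?_⟩
          have hle : (s.val.sort (· ≤ ·)).Pairwise (· ≤ ·) := Multiset.pairwise_sort _ _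
          have hne : (s.val.sort (· ≤ ·)).Pairwise (· ≠ ·) := by
            have : (s.val.sort (· ≤ ·)).Nodup := by
              rw [← Multiset.coe_nodup, Multiset.sort_eq]
              exact s.nodup
            exact this
          refine (hle.and hne).imp_of_mem ?_
          intro x y hx hy hxy
          exact h2 x ((Multiset.mem_sort _).1 hx) y ((Multiset.mem_sort _).1 hy)
            (lt_of_le_of_ne hxy.1 hxy.2)
    _ ≤ _ := Finset.card_image_le

end Transfer

/-! ### Reduction to an injection on the parts other than one. -/

section Injection

/-- Filling up with ones turns an injection on the parts other than one into an injection of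
partitions. -/
theorem card_le_card_sepSets_of_injection {r : ℕ} (hr : 2 ≤ r) (M n : ℕ)
    (A : Finset (Multiset ℕ)) (f : Multiset ℕ → Multiset ℕ) (hA : ∀ s ∈ A, s.sum = n)
    (hsum : ∀ s ∈ A, (f s).sum ≤ M) (hf : ∀ s ∈ A, ∀ x ∈ f s, x ≠ 1 ∧ IsOddPower r x)
    (hinj : ∀ s ∈ A, ∀ t ∈ A, f s = f t → s.filter (· ≠ 1) = t.filter (· ≠ 1)) :
    A.card ≤ (sepSets (2 ^ r - 1) M M).card := by
  have hone : IsOddPower r 1 := by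
    have := two_pow_lt_modulus hr (by omega : 0 < r)
    exact ⟨odd_one, 0, by omega, by rw [Nat.mod_eq_of_lt (by simpa using this), pow_zero]⟩
  have hsplit : ∀ s ∈ A, s = s.filter (· ≠ 1) + Multiset.replicate (s.count 1) 1 ∧
      (s.filter (· ≠ 1)).sum + s.count 1 = n := by
    intro s hs
    have h1 : s = s.filter (· ≠ 1) + Multiset.replicate (s.count 1) 1 := by
      have := Multiset.filter_add_not (· ≠ 1) s
      simp only [ne_eq, not_not, Multiset.filter_eq'] at this
      exact this.symm
    refine ⟨h1, ?_⟩
    have := congrArg Multiset.sum h1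
    rw [hA s hs, Multiset.sum_add, Multiset.sum_replicate, smul_eq_mul, mul_one] at this
    exact this.symm
  -- The subtraction does not truncate, by `hsum`. Since `f s` has no ones it can be read off from
  -- `g s`, and the number of ones in `s` is forced by its sum n.
  set g : Multiset ℕ → Multiset ℕ := fun s => f s + Multiset.replicate (M - (f s).sum) 1 with hg
  have hginj : Set.InjOn g A := by
    intro s hs t ht h
    have h1 : ∀ s ∈ A, (g s).filter (· ≠ 1) = f s := by
      intro s hs
      rw [hg, Multiset.filter_add, Multiset.filter_eq_self.2 fun x hx => (hf s hs x hx).1,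
        Multiset.filter_eq_nil.2, add_zero]
      intro x hx
      simp [Multiset.eq_of_mem_replicate hx]
    have h2 : f s = f t := by rw [← h1 s hs, ← h1 t ht, h]
    have h3 := hinj s hs t ht h2
    obtain ⟨hs1, hs2⟩ := hsplit s hs
    obtain ⟨ht1, ht2⟩ := hsplit t ht
    rw [hs1, ht1, h3]
    rw [h3] at hs2
    congr 2
    omega
  rw [← Finset.card_image_of_injOn hginj]
  apply card_oddPower_le_card_sepSets hr
  intro m hm
  obtain ⟨s, hs, rfl⟩ := Finset.mem_image.1 hm
  constructor
  · have := hsum s hs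
    simp only [hg, Multiset.sum_add, Multiset.sum_replicate, smul_eq_mul, mul_one]
    omega
  · intro x hx
    rcases Multiset.mem_add.1 hx with hx | hx
    · exact (hf s hs x hx).2
    · rw [Multiset.eq_of_mem_replicate hx]
      exact hone

/-- The multisets of the parts of the partitions counted by `congPartitionCountMinus`. -/
lemma exists_finset_congPartitionCountMinus {d : ℕ} (hd : 2 ≤ d) (n : ℕ) :
    ∃ A : Finset (Multiset ℕ), A.card = congPartitionCountMinus (d - 2) 1 n ∧
      ∀ s ∈ A, s.sum = n ∧ ∀ x ∈ s, (∃ k, x = k * (d + 1) + 1) ∨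
        ∃ k, 2 ≤ k ∧ x + 1 = k * (d + 1) := by
  refine ⟨(Finset.univ.filter fun p : n.Partition => ∀ x ∈ p.parts,
    ((x : ℤ) ≡ (1 : ℕ) [ZMOD (d - 2 : ℕ) + 3] ∨ (x : ℤ) ≡ -(1 : ℕ) [ZMOD (d - 2 : ℕ) + 3]) ∧
      (x : ℤ) ≠ (d - 2 : ℕ) + 3 - (1 : ℕ)).image Nat.Partition.parts, ?_, ?_⟩
  · rw [congPartitionCountMinus, Finset.card_image_of_injective]
    intro p q h
    exact Nat.Partition.ext h
  · intro s hs
    obtain ⟨p, hp, rfl⟩ := Finset.mem_image.1 hs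
    refine ⟨p.parts_sum, fun x hx => ?_⟩
    have hpos := p.parts_pos hx
    obtain ⟨h1, h2⟩ := (Finset.mem_filter.1 hp).2 x hx
    have e : (((d - 2 : ℕ) : ℤ) + 3) = ((d + 1 : ℕ) : ℤ) := by omega
    rw [e] at h1 h2
    rcases h1 with h1 | h1
    · left
      have h3 : (d + 1) ∣ x - 1 := (Nat.modEq_iff_dvd' hpos).1 (Int.natCast_modEq_iff.1 h1).symm
      obtain ⟨k, hk⟩ := h3
      exact ⟨k, by rw [mul_comm]; omega⟩
    · right
      have h3 := Int.modEq_iff_dvd.1 h1.symm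
      have h4 : ((d + 1 : ℕ) : ℤ) ∣ ((x + 1 : ℕ) : ℤ) := by
        convert h3 using 1
        push_cast
        ring
      obtain ⟨k, hk⟩ := Int.natCast_dvd_natCast.1 h4
      refine ⟨k, ?_, by rw [hk, mul_comm]⟩
      -- k = 0 is impossible, and k = 1 is the excluded part d.
      by_contra hlt
      rcases (by omega : k = 0 ∨ k = 1) with rfl | rfl
      · omega
      · apply h2
        push_cast
        omega

end Injection

/-! ### Shrinking individual parts. -/

section Parts

lemma map_inj_of_leftInverse {f g : ℕ → ℕ} {s t : Multiset ℕ} (hs : ∀ x ∈ s, g (f x) = x)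
    (ht : ∀ x ∈ t, g (f x) = x) (h : s.map f = t.map f) : s = t := by
  have h1 := congrArg (Multiset.map g) h
  rw [Multiset.map_map, Multiset.map_map] at h1
  simpa [Multiset.map_congr rfl hs, Multiset.map_congr rfl ht] using h1

/-- The image, for `d = 15`, of a part other than one. -/
def shrinkPart15 (x : ℕ) : ℕ :=
  -- The parity of the level selects the residue modulo 15 so that the image is odd: an odd multiple
  -- of 15 takes an even residue, an even multiple takes 1. The excluded part 15 is the one that
  -- would go to 1.
  if x % 16 = 1 then
    if (x / 16) % 2 = 0 then 15 * (x / 16 - 1) + 8 else 15 * (x / 16) + 2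
  else if (x / 16) % 2 = 1 then 15 * (x / 16) + 4 else 15 * (x / 16) + 1

/-- The inverse of `shrinkPart15`. -/
def growPart15 (y : ℕ) : ℕ :=
  if y % 15 = 2 then 16 * (y / 15) + 1
  else if y % 15 = 8 then 16 * (y / 15 + 1) + 1
  else 16 * (y / 15) + 15

lemma shrinkPart15_spec {x : ℕ} (h : (∃ k, x = k * 16 + 1) ∨ ∃ k, 2 ≤ k ∧ x + 1 = k * 16)
    (hx : x ≠ 1) : shrinkPart15 x ≤ x ∧ shrinkPart15 x ≠ 1 ∧ IsOddPower 4 (shrinkPart15 x) ∧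
      growPart15 (shrinkPart15 x) = x := by
  have key : shrinkPart15 x ≤ x ∧ shrinkPart15 x ≠ 1 ∧ shrinkPart15 x % 2 = 1 ∧
      (shrinkPart15 x % 15 = 1 ∨ shrinkPart15 x % 15 = 2 ∨ shrinkPart15 x % 15 = 4 ∨
        shrinkPart15 x % 15 = 8) ∧ growPart15 (shrinkPart15 x) = x := by
    rcases h with ⟨k, rfl⟩ | ⟨k, hk, hx'⟩
    · simp only [shrinkPart15, growPart15]
      split_ifs <;> omega
    · obtain ⟨k, rfl⟩ : ∃ j, k = j + 1 := ⟨k - 1, by omega⟩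
      obtain rfl : x = k * 16 + 15 := by omega
      simp only [shrinkPart15, growPart15]
      split_ifs <;> omega
  obtain ⟨h1, h2, h3, h4, h5⟩ := key
  refine ⟨h1, h2, ⟨Nat.odd_iff.2 h3, ?_⟩, h5⟩
  rcases h4 with h4 | h4 | h4 | h4
  · exact ⟨0, by norm_num, h4⟩
  · exact ⟨1, by norm_num, h4⟩
  · exact ⟨2, by norm_num, h4⟩
  · exact ⟨3, by norm_num, h4⟩

theorem congPartitionCountMinus_le_of_eq_fifteen (n : ℕ) :
    congPartitionCountMinus 13 1 n ≤ diffPartitionCount 15 1 n := by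
  obtain ⟨A, hcard, hA⟩ := exists_finset_congPartitionCountMinus (d := 15) (by norm_num) n
  rw [← hcard]
  refine le_trans ?_ (card_sepSets_le_diffPartitionCount 15 n)
  have hspec : ∀ s ∈ A, ∀ x ∈ s.filter (· ≠ 1), _ := fun s hs x hx =>
    shrinkPart15_spec ((hA s hs).2 x (Multiset.mem_filter.1 hx).1) (Multiset.mem_filter.1 hx).2
  refine card_le_card_sepSets_of_injection (r := 4) (by norm_num) n n A
    (fun s => (s.filter (· ≠ 1)).map shrinkPart15) (fun s hs => (hA s hs).1) ?_ ?_ ?_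
  · intro s hs
    calc ((s.filter (· ≠ 1)).map shrinkPart15).sum ≤ ((s.filter (· ≠ 1)).map id).sum :=
          Multiset.sum_map_le_sum_map _ _ fun x hx => (hspec s hs x hx).1
      _ ≤ s.sum := by
          rw [Multiset.map_id, ← Multiset.filter_add_not (· ≠ 1) s, Multiset.sum_add]
          simp
      _ = n := (hA s hs).1
  · intro s hs y hy
    obtain ⟨x, hx, rfl⟩ := Multiset.mem_map.1 hy
    exact ⟨(hspec s hs x hx).2.1, (hspec s hs x hx).2.2.1⟩
  · intro s hs t ht h
    exact map_inj_of_leftInverse (fun x hx => (hspec s hs x hx).2.2.2)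
      (fun x hx => (hspec t ht x hx).2.2.2) h

/-- The multiple of `d + 1` next to the part `x` is `partLevel d x * (d + 1)`. -/
def partLevel (d x : ℕ) : ℕ := (x + 1) / (d + 1)

lemma partLevel_add {d : ℕ} (hd : 2 ≤ d) (k : ℕ) : partLevel d (k * (d + 1) + 1) = k := by
  rw [partLevel, show k * (d + 1) + 1 + 1 = 2 + (d + 1) * k by ring,
    Nat.add_mul_div_left _ _ (by omega), Nat.div_eq_of_lt (by omega), zero_add]

lemma partLevel_sub {d k x : ℕ} (h : x + 1 = k * (d + 1)) : partLevel d x = k := by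
  rw [partLevel, h, Nat.mul_div_cancel _ (by omega)]

lemma mod_add {d : ℕ} (hd : 2 ≤ d) (k : ℕ) : (k * (d + 1) + 1) % (d + 1) = 1 := by
  rw [add_comm, Nat.add_mul_mod_self_right, Nat.mod_eq_of_lt (by omega)]

lemma mod_sub {d k x : ℕ} (hd : 2 ≤ d) (h : x + 1 = k * (d + 1)) : x % (d + 1) ≠ 1 := by
  intro h1
  have h2 : (x + 1) % (d + 1) = 2 := by
    rw [Nat.add_mod, h1, Nat.mod_eq_of_lt (by omega : 1 < d + 1), Nat.mod_eq_of_lt (by omega)]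
  rw [h, Nat.mul_mod_left] at h2
  omega

/-- The image, as a residue modulo `31` and a level, of a part other than `1`, `d + 2`
and `3 * d + 4`. -/
def shrinkPart (d x : ℕ) : ℕ :=
  -- From level 4 on, images are odd multiples of 31 plus one of 2, 4, 8, 16, with parity of the
  -- level and sign of the residue choosing which. At levels 2 and 3 this rule would use 33 and 47,
  -- which are needed for d + 2; hence the special values 35, 39 and 63.
  if x % (d + 1) = 1 then
    if partLevel d x = 2 then 39
    else if partLevel d x % 2 = 0 then 31 * (partLevel d x - 1) + 4
    else 31 * (partLevel d x - 2) + 16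
  else
    if partLevel d x = 2 then 35
    else if partLevel d x = 3 then 63
    else if partLevel d x % 2 = 0 then 31 * (partLevel d x - 1) + 2
    else 31 * (partLevel d x - 2) + 8

/-- The inverse of `shrinkPart`. -/
def growPart (d y : ℕ) : ℕ :=
  if y = 39 then 2 * (d + 1) + 1
  else if y = 35 then 2 * (d + 1) - 1
  else if y = 63 then 3 * (d + 1) - 1
  else if y % 31 = 4 then (y / 31 + 1) * (d + 1) + 1
  else if y % 31 = 16 then (y / 31 + 2) * (d + 1) + 1
  else if y % 31 = 2 then (y / 31 + 1) * (d + 1) - 1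
  else (y / 31 + 2) * (d + 1) - 1

lemma isOddPower_five {y : ℕ} (h1 : y % 2 = 1) (h2 : y % 31 = 1 ∨ y % 31 = 2 ∨ y % 31 = 4 ∨
    y % 31 = 8 ∨ y % 31 = 16) : IsOddPower 5 y := by
  refine ⟨Nat.odd_iff.2 h1, ?_⟩
  rcases h2 with h | h | h | h | h
  · exact ⟨0, by norm_num, h⟩
  · exact ⟨1, by norm_num, h⟩
  · exact ⟨2, by norm_num, h⟩
  · exact ⟨3, by norm_num, h⟩
  · exact ⟨4, by norm_num, h⟩

lemma growPart_shrinkPart {d x : ℕ} (hd : 2 ≤ d)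
    (h : (∃ k, x = k * (d + 1) + 1) ∨ ∃ k, 2 ≤ k ∧ x + 1 = k * (d + 1)) (h1 : x ≠ 1)
    (h2 : x ≠ d + 2) (h3 : x ≠ 3 * d + 4) : growPart d (shrinkPart d x) = x := by
  rcases h with ⟨k, rfl⟩ | ⟨k, hk, hx⟩
  · have hk : k = 2 ∨ 4 ≤ k := by
      by_contra hlt
      rcases (by omega : k = 0 ∨ k = 1 ∨ k = 3) with rfl | rfl | rfl <;> omega
    rw [shrinkPart, if_pos (mod_add hd k), partLevel_add hd]
    split_ifs with h4 h5
    · rw [growPart, if_pos rfl, h4]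
    · rw [growPart, if_neg (by omega), if_neg (by omega), if_neg (by omega), if_pos (by omega),
        show (31 * (k - 1) + 4) / 31 + 1 = k by omega]
    · rw [growPart, if_neg (by omega), if_neg (by omega), if_neg (by omega), if_neg (by omega),
        if_pos (by omega), show (31 * (k - 2) + 16) / 31 + 2 = k by omega]
  · rw [shrinkPart, if_neg (mod_sub hd hx), partLevel_sub hx]
    have hx' : x = k * (d + 1) - 1 := by omega
    split_ifs with h4 h5 h6
    · rw [growPart, if_neg (by omega), if_pos rfl, hx', h4]
    · rw [growPart, if_neg (by omega), if_neg (by omega), if_pos rfl, hx', h5]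
    · rw [growPart, if_neg (by omega), if_neg (by omega), if_neg (by omega), if_neg (by omega),
        if_neg (by omega), if_pos (by omega), show (31 * (k - 1) + 2) / 31 + 1 = k by omega, hx']
    · rw [growPart, if_neg (by omega), if_neg (by omega), if_neg (by omega), if_neg (by omega),
        if_neg (by omega), if_neg (by omega), show (31 * (k - 2) + 8) / 31 + 2 = k by omega, hx']

lemma shrinkPart_spec {d x : ℕ} (hd : 2 ≤ d)
    (h : (∃ k, x = k * (d + 1) + 1) ∨ ∃ k, 2 ≤ k ∧ x + 1 = k * (d + 1)) (h1 : x ≠ 1)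
    (h2 : x ≠ d + 2) (h3 : x ≠ 3 * d + 4) :
    shrinkPart d x ≤ 31 * partLevel d x ∧ shrinkPart d x ≠ 1 ∧ shrinkPart d x ≠ 33 ∧
      shrinkPart d x ≠ 47 ∧ IsOddPower 5 (shrinkPart d x) := by
  rcases h with ⟨k, rfl⟩ | ⟨k, hk, hx⟩
  · have hk : k = 2 ∨ 4 ≤ k := by
      by_contra hlt
      rcases (by omega : k = 0 ∨ k = 1 ∨ k = 3) with rfl | rfl | rfl <;> omega
    rw [shrinkPart, if_pos (mod_add hd k), partLevel_add hd]
    split_ifs <;>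
      exact ⟨by omega, by omega, by omega, by omega, isOddPower_five (by omega) (by omega)⟩
  · rw [shrinkPart, if_neg (mod_sub hd hx), partLevel_sub hx]
    split_ifs <;>
      exact ⟨by omega, by omega, by omega, by omega, isOddPower_five (by omega) (by omega)⟩

/-- At level k a part exceeds d * k by k + 1 or k - 1. This surplus is 1 only for x = 2 * d + 1. -/
lemma partLevel_spec {d x : ℕ} (hd : 2 ≤ d)
    (h : (∃ k, x = k * (d + 1) + 1) ∨ ∃ k, 2 ≤ k ∧ x + 1 = k * (d + 1)) (h1 : x ≠ 1)
    (h2 : x ≠ d + 2) :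
    2 ≤ partLevel d x ∧ d * partLevel d x + 1 ≤ x ∧
      (x = 2 * d + 1 ∨ d * partLevel d x + 2 ≤ x) := by
  rcases h with ⟨k, rfl⟩ | ⟨k, hk, hx⟩
  · have hk : 2 ≤ k := by
      by_contra hlt
      rcases (by omega : k = 0 ∨ k = 1) with rfl | rfl <;> omega
    have e : k * (d + 1) = d * k + k := by ring
    rw [partLevel_add hd, e]
    omega
  · have e : k * (d + 1) = d * k + k := by ring
    rw [partLevel_sub hx]
    rw [e] at hx
    by_cases h4 : k = 2
    · subst h4; omega
    · omega

end Parts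

/-! ### The case d ≥ 31. -/

section LargeDifference

/-- The parts other than `1`, `d + 2` and `3 * d + 4`. -/
def regularParts (d : ℕ) (s : Multiset ℕ) : Multiset ℕ :=
  s.filter fun x => x ≠ 1 ∧ x ≠ d + 2 ∧ x ≠ 3 * d + 4

lemma regularParts_decomposition {d : ℕ} (hd : 1 ≤ d) (s : Multiset ℕ) :
    s = regularParts d s + Multiset.replicate (s.count (d + 2)) (d + 2)
      + Multiset.replicate (s.count (3 * d + 4)) (3 * d + 4)
      + Multiset.replicate (s.count 1) 1 := by
  ext x
  simp only [regularParts, Multiset.count_add, Multiset.count_filter, Multiset.count_replicate]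
  by_cases h1 : x = 1
  · subst h1
    rw [if_neg (by omega), if_neg (by omega), if_neg (by omega), if_pos rfl]
    omega
  by_cases h2 : x = d + 2
  · subst h2
    rw [if_neg (by omega), if_pos rfl, if_neg (by omega), if_neg (by omega)]
    omega
  by_cases h3 : x = 3 * d + 4
  · subst h3
    rw [if_neg (by omega), if_neg (by omega), if_pos rfl, if_neg (by omega)]
    omega
  rw [if_pos ⟨h1, h2, h3⟩, if_neg (Ne.symm h2), if_neg (Ne.symm h3), if_neg (Ne.symm h1)]
  omega

/-- The image of a multiset of parts, without the ones. -/
def shrinkParts (d : ℕ) (s : Multiset ℕ) : Multiset ℕ :=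
  -- No admissible odd integer other than 1 is at most 31, so a single d + 2 cannot be shrunk within
  -- its level. Pairs of d + 2 go to 47 ≤ 62, a leftover one to 33 = 31 + 2, and 3 * d + 4 to two
  -- copies of 33, with 66 ≤ 93. The parity of the number of 33s keeps the encoding injective.
  (regularParts d s).map (shrinkPart d)
    + Multiset.replicate (s.count (d + 2) % 2 + 2 * s.count (3 * d + 4)) 33
    + Multiset.replicate (s.count (d + 2) / 2) 47

variable {d : ℕ} {s t : Multiset ℕ}

lemma shrinkParts_inj (hd : 2 ≤ d)
    (hs : ∀ x ∈ s, (∃ k, x = k * (d + 1) + 1) ∨ ∃ k, 2 ≤ k ∧ x + 1 = k * (d + 1))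
    (ht : ∀ x ∈ t, (∃ k, x = k * (d + 1) + 1) ∨ ∃ k, 2 ≤ k ∧ x + 1 = k * (d + 1))
    (h : shrinkParts d s = shrinkParts d t) : s.filter (· ≠ 1) = t.filter (· ≠ 1) := by
  have key : ∀ s : Multiset ℕ,
      (∀ x ∈ s, (∃ k, x = k * (d + 1) + 1) ∨ ∃ k, 2 ≤ k ∧ x + 1 = k * (d + 1)) →
      (shrinkParts d s).filter (fun y => y ≠ 33 ∧ y ≠ 47) = (regularParts d s).map (shrinkPart d) ∧
      (shrinkParts d s).count 33 = s.count (d + 2) % 2 + 2 * s.count (3 * d + 4) ∧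
      (shrinkParts d s).count 47 = s.count (d + 2) / 2 ∧
      ∀ x ∈ regularParts d s, growPart d (shrinkPart d x) = x := by
    intro s hs
    have h1 : ∀ y ∈ (regularParts d s).map (shrinkPart d), y ≠ 33 ∧ y ≠ 47 := by
      intro y hy
      obtain ⟨x, hx, rfl⟩ := Multiset.mem_map.1 hy
      obtain ⟨hx, hx1, hx2, hx3⟩ := Multiset.mem_filter.1 hx
      obtain ⟨-, -, h1, h2, -⟩ := shrinkPart_spec hd (hs x hx) hx1 hx2 hx3
      exact ⟨h1, h2⟩
    refine ⟨?_, ?_, ?_, ?_⟩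
    · rw [shrinkParts, Multiset.filter_add, Multiset.filter_add, Multiset.filter_eq_self.2 h1,
        Multiset.filter_eq_nil.2, Multiset.filter_eq_nil.2, add_zero, add_zero]
      · intro x hx; simp [Multiset.eq_of_mem_replicate hx]
      · intro x hx; simp [Multiset.eq_of_mem_replicate hx]
    · rw [shrinkParts, Multiset.count_add, Multiset.count_add,
        Multiset.count_eq_zero_of_notMem fun h => (h1 _ h).1 rfl, Multiset.count_replicate,
        Multiset.count_replicate, if_pos rfl, if_neg (by norm_num)]
      omega
    · rw [shrinkParts, Multiset.count_add, Multiset.count_add,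
        Multiset.count_eq_zero_of_notMem fun h => (h1 _ h).2 rfl, Multiset.count_replicate,
        Multiset.count_replicate, if_pos rfl, if_neg (by norm_num)]
      omega
    · intro x hx
      obtain ⟨hx, hx1, hx2, hx3⟩ := Multiset.mem_filter.1 hx
      exact growPart_shrinkPart hd (hs x hx) hx1 hx2 hx3
  obtain ⟨s1, s2, s3, s4⟩ := key s hs
  obtain ⟨t1, t2, t3, t4⟩ := key t ht
  have h1 : regularParts d s = regularParts d t :=
    map_inj_of_leftInverse s4 t4 (by rw [← s1, ← t1, h])
  rw [h] at s2 s3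
  have h2 : s.count (d + 2) = t.count (d + 2) := by omega
  have h3 : s.count (3 * d + 4) = t.count (3 * d + 4) := by omega
  have e : ∀ s : Multiset ℕ, s.filter (· ≠ 1) = regularParts d s
      + Multiset.replicate (s.count (d + 2)) (d + 2)
      + Multiset.replicate (s.count (3 * d + 4)) (3 * d + 4) := by
    intro s
    nth_rewrite 1 [regularParts_decomposition (by omega : 1 ≤ d) s]
    rw [Multiset.filter_add, Multiset.filter_eq_self.2, Multiset.filter_eq_nil.2, add_zero]
    · intro x hx; simp [Multiset.eq_of_mem_replicate hx]
    · intro x hx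
      rcases Multiset.mem_add.1 hx with hx | hx
      · rcases Multiset.mem_add.1 hx with hx | hx
        · exact (Multiset.mem_filter.1 hx).2.1
        · rw [Multiset.eq_of_mem_replicate hx]; omega
      · rw [Multiset.eq_of_mem_replicate hx]; omega
  rw [e s, e t, h1, h2, h3]

lemma shrinkParts_spec (hd : 2 ≤ d)
    (hs : ∀ x ∈ s, (∃ k, x = k * (d + 1) + 1) ∨ ∃ k, 2 ≤ k ∧ x + 1 = k * (d + 1)) :
    ∀ x ∈ shrinkParts d s, x ≠ 1 ∧ IsOddPower 5 x := by
  intro y hy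
  rcases Multiset.mem_add.1 hy with hy | hy
  · rcases Multiset.mem_add.1 hy with hy | hy
    · obtain ⟨x, hx, rfl⟩ := Multiset.mem_map.1 hy
      obtain ⟨hx, hx1, hx2, hx3⟩ := Multiset.mem_filter.1 hx
      obtain ⟨-, h1, -, -, h2⟩ := shrinkPart_spec hd (hs x hx) hx1 hx2 hx3
      exact ⟨h1, h2⟩
    · rw [Multiset.eq_of_mem_replicate hy]
      exact ⟨by norm_num, isOddPower_five (by norm_num) (by norm_num)⟩
  · rw [Multiset.eq_of_mem_replicate hy]
    exact ⟨by norm_num, isOddPower_five (by norm_num) (by norm_num)⟩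

lemma sum_shrinkParts_le (hd : 2 ≤ d)
    (hs : ∀ x ∈ s, (∃ k, x = k * (d + 1) + 1) ∨ ∃ k, 2 ≤ k ∧ x + 1 = k * (d + 1)) :
    (shrinkParts d s).sum ≤ 31 * (((regularParts d s).map (partLevel d)).sum + s.count (d + 2)
      + 3 * s.count (3 * d + 4)) + 2 * (s.count (d + 2) % 2) := by
  have h1 : ((regularParts d s).map (shrinkPart d)).sum
      ≤ ((regularParts d s).map fun x => 31 * partLevel d x).sum := by
    refine Multiset.sum_map_le_sum_map _ _ fun x hx => ?_
    obtain ⟨hx, hx1, hx2, hx3⟩ := Multiset.mem_filter.1 hx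
    exact (shrinkPart_spec hd (hs x hx) hx1 hx2 hx3).1
  rw [Multiset.sum_map_mul_left] at h1
  simp only [shrinkParts, Multiset.sum_add, Multiset.sum_replicate, smul_eq_mul]
  omega

/-- The surplus over d times the total level adds up over the parts. It is at least 2 unless there
are no regular parts or just the part 2 * d + 1; this pays for δ = 2. -/
lemma regularParts_sum_bound (hd : 2 ≤ d)
    (hs : ∀ x ∈ s, (∃ k, x = k * (d + 1) + 1) ∨ ∃ k, 2 ≤ k ∧ x + 1 = k * (d + 1)) :
    2 * (regularParts d s).card ≤ ((regularParts d s).map (partLevel d)).sum ∧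
    d * ((regularParts d s).map (partLevel d)).sum + (regularParts d s).card
      ≤ (regularParts d s).sum ∧
    (regularParts d s = 0 ∨ (regularParts d s).sum = 2 * d + 1 ∨
      d * ((regularParts d s).map (partLevel d)).sum + 2 ≤ (regularParts d s).sum) := by
  have hF : ∀ x ∈ regularParts d s, 2 ≤ partLevel d x ∧ d * partLevel d x + 1 ≤ x ∧
      (x = 2 * d + 1 ∨ d * partLevel d x + 2 ≤ x) := by
    intro x hx
    obtain ⟨hx, hx1, hx2, hx3⟩ := Multiset.mem_filter.1 hx
    exact partLevel_spec hd (hs x hx) hx1 hx2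
  generalize regularParts d s = F at hF
  have hcard : ∀ F : Multiset ℕ, (∀ x ∈ F, 2 ≤ partLevel d x ∧ d * partLevel d x + 1 ≤ x ∧
      (x = 2 * d + 1 ∨ d * partLevel d x + 2 ≤ x)) →
      2 * F.card ≤ (F.map (partLevel d)).sum ∧
      d * (F.map (partLevel d)).sum + F.card ≤ F.sum := by
    intro F
    induction F using Multiset.induction_on with
    | empty => simp
    | cons x F ih =>
      intro hF
      obtain ⟨i1, i2⟩ := ih fun y hy => hF y (Multiset.mem_cons_of_mem hy)
      obtain ⟨h1, h2, -⟩ := hF x (Multiset.mem_cons_self x F)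
      simp only [Multiset.card_cons, Multiset.map_cons, Multiset.sum_cons, mul_add]
      omega
  refine ⟨(hcard F hF).1, (hcard F hF).2, ?_⟩
  induction F using Multiset.induction_on with
  | empty => exact Or.inl rfl
  | cons x F _ =>
    right
    obtain ⟨-, h2, h3⟩ := hF x (Multiset.mem_cons_self x F)
    obtain ⟨-, i2⟩ := hcard F fun y hy => hF y (Multiset.mem_cons_of_mem hy)
    simp only [Multiset.map_cons, Multiset.sum_cons, mul_add]
    rcases Nat.eq_zero_or_pos F.card with h | h
    · rw [Multiset.card_eq_zero] at h
      subst h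
      simpa using h3
    · right
      omega

theorem congPartitionCountMinus_le_of_large (hd : 31 ≤ d) {n : ℕ} (hn : 1 ≤ n) :
    congPartitionCountMinus (d - 2) 1 n ≤ diffPartitionCount d 1 n := by
  have hd2 : 2 ≤ d := by omega
  obtain ⟨A, hcard, hA⟩ := exists_finset_congPartitionCountMinus hd2 n
  rw [← hcard]
  refine le_trans ?_ (card_sepSets_le_diffPartitionCount d n)
  suffices h : ∃ K δ, (δ = 1 ∨ δ = 2) ∧ d * K + δ ≤ n ∧
      ∀ s ∈ A, (shrinkParts d s).sum ≤ 31 * K + δ by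
    obtain ⟨K, δ, hδ, hK, hsum⟩ := h
    exact (card_le_card_sepSets_of_injection (r := 5) (by norm_num) (31 * K + δ) n A
      (shrinkParts d) (fun s hs => (hA s hs).1) hsum
      (fun s hs => shrinkParts_spec hd2 (hA s hs).2)
      (fun s hs t ht => shrinkParts_inj hd2 (hA s hs).2 (hA t ht).2)).trans
      (card_sepSets_stretch hd hδ hK)
  have hbound : ∀ s ∈ A, (regularParts d s).sum + s.count (d + 2) * (d + 2)
      + s.count (3 * d + 4) * (3 * d + 4) + s.count 1 = n := by
    intro s hs
    have := congrArg Multiset.sum (regularParts_decomposition (by omega : 1 ≤ d) s)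
    simpa [(hA s hs).1] using this.symm
  by_cases h1 : n = 1
  -- Here n is too small for δ = 2; only ones occur.
  · refine ⟨0, 1, Or.inl rfl, by omega, fun s hs => ?_⟩
    have h2 := sum_shrinkParts_le hd2 (hA s hs).2
    obtain ⟨-, h3, -⟩ := regularParts_sum_bound hd2 (hA s hs).2
    have h4 := hbound s hs
    generalize s.count (d + 2) = a at *
    generalize s.count (3 * d + 4) = c at *
    generalize ((regularParts d s).map (partLevel d)).sum = L at *
    have ha : a = 0 := by by_contra h; nlinarith [Nat.pos_of_ne_zero h]
    have hc : c = 0 := by by_contra h; nlinarith [Nat.pos_of_ne_zero h]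
    have hL : L = 0 := by by_contra h; nlinarith [Nat.pos_of_ne_zero h]
    subst ha hc hL
    omega
  by_cases h2 : n = 2 * d + 1
  -- The single part 2 * d + 1 has level 2 and surplus 1, while (n - 2) / d would be 1. With δ = 1
  -- there is no reserve for a leftover d + 2, but then no regular part fits beside it.
  · refine ⟨2, 1, Or.inl rfl, by omega, fun s hs => ?_⟩
    have h3 := sum_shrinkParts_le hd2 (hA s hs).2
    obtain ⟨h4, h5, -⟩ := regularParts_sum_bound hd2 (hA s hs).2
    have h6 := hbound s hs
    have h7 : (regularParts d s).card = 0 → ((regularParts d s).map (partLevel d)).sum = 0 := by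
      intro h
      rw [Multiset.card_eq_zero.1 h]
      rfl
    generalize s.count (d + 2) = a at *
    generalize s.count (3 * d + 4) = c at *
    generalize ((regularParts d s).map (partLevel d)).sum = L at *
    generalize (regularParts d s).card = C at *
    have hle : L + a + 3 * c ≤ 2 := by
      by_contra h
      have : d * 3 ≤ d * (L + a + 3 * c) := Nat.mul_le_mul_left _ (by omega)
      nlinarith
    omega
  -- The extra 2 in the target sum absorbs 33 = 31 + 2 for a leftover d + 2. Total level at most (n
  -- - 2) / d means a total surplus of at least 2: from d + 2, from 3 * d + 4, from the regular
  -- parts, or, when these give less, from the ones.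
  · refine ⟨(n - 2) / d, 2, Or.inr rfl, ?_, fun s hs => ?_⟩
    · have := Nat.mul_div_le (n - 2) d
      omega
    · have h3 := sum_shrinkParts_le hd2 (hA s hs).2
      obtain ⟨-, h5, h6⟩ := regularParts_sum_bound hd2 (hA s hs).2
      have h7 := hbound s hs
      have h8 : regularParts d s = 0 → ((regularParts d s).map (partLevel d)).sum = 0 := by
        intro h
        rw [h]
        rfl
      generalize s.count (d + 2) = a at *
      generalize s.count (3 * d + 4) = c at *
      have hle : ((regularParts d s).map (partLevel d)).sum + a + 3 * c ≤ (n - 2) / d := by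
        rw [Nat.le_div_iff_mul_le (by omega)]
        have e1 : (((regularParts d s).map (partLevel d)).sum + a + 3 * c) * d
            = d * ((regularParts d s).map (partLevel d)).sum + a * d + c * (3 * d) := by ring
        have e2 : a * (d + 2) = a * d + 2 * a := by ring
        have e3 : c * (3 * d + 4) = c * (3 * d) + 4 * c := by ring
        rw [e1]
        rw [e2, e3] at h7
        rcases Nat.eq_zero_or_pos a with rfl | ha
        · rcases Nat.eq_zero_or_pos c with rfl | hc
          · rcases h6 with h6 | h6 | h6
            · rw [h8 h6]
              omega
            · have h9 : 1 ≤ (regularParts d s).card := by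
                rw [Nat.one_le_iff_ne_zero, Ne, Multiset.card_eq_zero]
                intro h
                rw [h] at h6
                simp at h6
              omega
            · omega
          · omega
        · omega
      omega

end LargeDifference

theorem mainTheorem2 (d : ℕ) (hd : d = 15 ∨ 31 ≤ d) (n : ℕ) (hn : 1 ≤ n) :
    diffPartitionCount d 1 n ≥ congPartitionCountMinus (d - 2) 1 n := by
  rcases hd with rfl | hd
  · exact congPartitionCountMinus_le_of_eq_fifteen n
  · exact congPartitionCountMinus_le_of_large hd hn
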